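/- **Setting.** For $p\in\mathbf N$ let $\mathbf F_p=\{m\,2^e : m,e\in\mathbf Z,\ |m|<2^p\}$ (binary floating point numbers with $p$-bit significand and unbounded exponent, so that neither underflow nor overflow occurs), let $\mathrm{fl}:\mathbf R\to\mathbf F_p$ be any rounding to a nearest element of $\mathbf F_p$ (ties broken arbitrarily), and put $a\star b=\mathrm{fl}(a\circ b)$ for $\circ\in\{+,-,\times\}$, written $\oplus,\ominus,\otimes$. The unit round-off is $\mathbf u=2^{-p}$. $[S,\sigma]=\mathtt{TwoSum}(a,b)$ is Knuth's algorithm $S=a\oplus b$, $z=S\ominus a$, $\sigma=(a\ominus(S\ominus z))\oplus(b\ominus z)$. $[P,\pi]=\mathtt{TwoProd}(a,b)$ is Dekker's algorithm $P=a\otimes b$, $\pi=a_\ell\otimes b_\ell\ominus(((P\ominus a_h\otimes b_h)\ominus a_\ell\otimes b_h)\ominus a_h\otimes b_\ell)$, where $a$ (likewise $b$) is split by $z=a\otimes(2^{\lceil p/2\rceil}+1)$, $a_h=z\ominus(z\ominus a)$, $a_\ell=a\ominus a_h$. **Exact and computed values.** Given $b_0,\dots,b_n$ and $s$, the exact de Casteljau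 values are $b_j^{(n)}=b_j$, $b_j^{(k)}=(1-s)b_j^{(k+1)}+s\,b_{j+1}^{(k+1)}$ for $0\le j\le k<n$. The computed values are $\widehat b_j^{(n)}=b_j$, $\widehat{\partial^F b}_j^{(n)}=0$ for $F\ge1$ (with $\widehat{\partial^0b}=\widehat b$), and, with $[\widehat r,\rho]=\mathtt{TwoSum}(1,-s)$, for $k=n-1,\dots,0$ and $0\le j\le k$: * Level $0$: $[P_1,e_1]=\mathtt{TwoProd}(\widehat r,\widehat b_j^{(k+1)})$, $[P_2,e_2]=\mathtt{TwoProd}(s,\widehat b_{j+1}^{(k+1)})$, $[\widehat b_j^{(k)},e_3]=\mathtt{TwoSum}(P_1,P_2)$. * Level $F\ge1$: let $e_1,\dots,e_{L}$, $L=5F-2$, be the round-off errors recorded at level $F-1$. Compute $\widehat\ell=e_1\oplus\cdots\oplus e_L\oplus(\rho\otimes\widehat{\partial^{F-1}b}_j^{(k+1)})$ (from left to right) and then $\widehat{\partial^{F}b}_j^{(k)}=\bigl(\widehat\ell\oplus(s\otimes\widehat{\partial^{F}b}_{j+1}^{(k+1)})\bigr)\oplus(\widehat r\otimes\widehat{\partial^{F}b}_j^{(k+1)})$,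 each sum by $\mathtt{TwoSum}$ and each product by $\mathtt{TwoProd}$; the $5F+3$ second components of these, in the order of execution, are the round-off errors recorded at level $F$. The global errors are $\partial^0b=b$ and $\partial^{F+1}b_j^{(k)}=\partial^{F}b_j^{(k)}-\widehat{\partial^{F}b}_j^{(k)}$ for $F\ge 0$. Finally $\widetilde p(s)=\sum_{j=0}^n|b_j|B_{j,n}(s)$ with $B_{j,n}(s)=\binom nj(1-s)^{n-j}s^j$. **Lemma.** Let $K\ge1$. Then $$\Bigl|\partial^{K-1}b_0^{(0)}-\widehat{\partial^{K-1}b}_0^{(0)}\Bigr|=\Bigl|\partial^{K}b_0^{(0)}\Bigr|\le\Bigl[\Bigl(3^K\binom nK+O(n^{K-1})\Bigr)\mathbf u^K+O(\mathbf u^{K+1})\Bigr]\,\widetilde p(s)$$ for $s\in[0,1]\cap\mathbf F_p$ and $b_0,\dots,b_n\in\mathbf F_p$, in the following sense: there is a constant $C=C(K)$ such that for every $n\ge0$ there are constants $D=D(K,n)$ and $u_0=u_0(K,n)>0$ such that, for all $p$ with $\mathbf u=2^{-p}\le u_0$, all roundings to nearest $\mathrm{fl}$, and all such $b_0,\dots,b_n$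 and $s$, the equality above holds and $$\Bigl|\partial^{K}b_0^{(0)}\Bigr|\le\Bigl[\Bigl(3^K\binom nK+C\,n^{K-1}\Bigr)\mathbf u^K+D\,\mathbf u^{K+1}\Bigr]\,\widetilde p(s),$$ where $0^0=1$. -/

import Mathlib

namespace KCompensated

/-! ### Binary floating point arithmetic without underflow or overflow -/

/-- `x` is a binary floating point number with a `p`-bit significand; the exponent is unbounded,
so that neither underflow nor overflow occurs. -/
def IsFloat (p : ℕ) (x : ℝ) : Prop :=
  ∃ m e : ℤ, |m| < 2 ^ p ∧ x = (m : ℝ) * (2 : ℝ) ^ e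

/-- `fl` rounds every real number to a nearest `p`-bit floating point number (ties are broken
in an arbitrary way). The floating point operations are `fl (a + b)`, `fl (a - b)`,
`fl (a * b)`. -/
structure IsRoundToNearest (p : ℕ) (fl : ℝ → ℝ) : Prop where
  isFloat : ∀ x, IsFloat p (fl x)
  nearest : ∀ x y, IsFloat p y → |x - fl x| ≤ |x - y|

/-- The unit round-off `𝐮 = 2 ^ (-p)` (`2 ^ (-53)` in double precision). -/
noncomputable def unitRoundoff (p : ℕ) : ℝ := (2 : ℝ)⁻¹ ^ p

/-! ### Error-free transformations -/

/-- Knuth's `TwoSum` (6 flops): `[S, σ]`. -/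
def twoSum (fl : ℝ → ℝ) (a b : ℝ) : ℝ × ℝ :=
  let S := fl (a + b)
  let z := fl (S - a)
  (S, fl (fl (a - fl (S - z)) + fl (b - z)))

/-- Splitting of a `p`-bit number into a high and a low part (4 flops), with
`r = ⌈p / 2⌉` (`r = 27` in double precision). -/
def split (p : ℕ) (fl : ℝ → ℝ) (a : ℝ) : ℝ × ℝ :=
  let r := (p + 1) / 2
  let z := fl (a * (2 ^ r + 1))
  let h := fl (z - fl (z - a))
  (h, fl (a - h))

/-- Dekker's `TwoProd` (17 flops): `[P, π]`. -/
def twoProd (p : ℕ) (fl : ℝ → ℝ) (a b : ℝ) : ℝ × ℝ :=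
  let P := fl (a * b)
  let a' := split p fl a
  let b' := split p fl b
  (P, fl (fl (a'.2 * b'.2) -
        fl (fl (fl (P - fl (a'.1 * b'.1)) - fl (a'.2 * b'.1)) - fl (a'.1 * b'.2))))

/-! ### Local errors -/

/-- `acc ⊕ x₁ ⊕ x₂ ⊕ ⋯` (from left to right) by successive `TwoSum`s: the list of the round-off
errors, and the computed sum. -/
def sumEFT (fl : ℝ → ℝ) : ℝ → List ℝ → List ℝ × ℝ
  | acc, [] => ([], acc)
  | acc, x :: xs =>
    let t := twoSum fl acc x
    let rest := sumEFT fl t.1 xs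
    (t.2 :: rest.1, rest.2)

/-- `LocalErrorEFT (e, ρ, δb)`: the pair `[η, ℓ̂]` of the list of all round-off errors and the
computed value of `e₁ + ⋯ + e_L + ρ * δb`. -/
def localErrorEFT (p : ℕ) (fl : ℝ → ℝ) (e : List ℝ) (ρ δb : ℝ) : List ℝ × ℝ :=
  let t := sumEFT fl (e.headD 0) e.tail
  let P := twoProd p fl ρ δb
  let l := twoSum fl t.2 P.1
  (t.1 ++ [P.2, l.2], l.1)

/-- `LocalError (e, ρ, δb)`, the version without error-free transformations. -/
def localError (fl : ℝ → ℝ) (e : List ℝ) (ρ δb : ℝ) : ℝ :=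
  fl (e.tail.foldl (fun acc x => fl (acc + x)) (e.headD 0) + fl (ρ * δb))

/-! ### The cascade of computed values -/

/-- One pass through the body of the double loop of the `K`-compensated de Casteljau algorithm.
`v F j` is the current (superscript `k + 1`) computed value at level `F`: `b̂_j` for `F = 0` and
`∂^F b̂_j` for `F ≥ 1`. The result of `stage … v j F` is the new (superscript `k`) computed value
at level `F` and index `j`, together with the list of the round-off errors
(`3` of them for `F = 0`, `5` more at each further level) made when it was computed. -/
def stage (p : ℕ) (fl : ℝ → ℝ) (s : ℝ) (v : ℕ → ℕ → ℝ) (j : ℕ) : ℕ → ℝ × List ℝ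
  | 0 =>
    let rh := (twoSum fl 1 (-s)).1
    let P₁ := twoProd p fl rh (v 0 j)
    let P₂ := twoProd p fl s (v 0 (j + 1))
    let S := twoSum fl P₁.1 P₂.1
    (S.1, [P₁.2, P₂.2, S.2])
  | F + 1 =>
    let rh := (twoSum fl 1 (-s)).1
    let ρ := (twoSum fl 1 (-s)).2
    let l := localErrorEFT p fl (stage p fl s v j F).2 ρ (v F j)
    let P₁ := twoProd p fl s (v (F + 1) (j + 1))
    let S₂ := twoSum fl l.2 P₁.1
    let P₃ := twoProd p fl rh (v (F + 1) j)
    let S := twoSum fl S₂.1 P₃.1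
    (S.1, l.1 ++ [P₁.2, S₂.2, P₃.2, S.2])

/-- The values of all levels after `i` passes of the outer loop, i.e. with superscript `n - i`. -/
def table (p : ℕ) (fl : ℝ → ℝ) (b : ℕ → ℝ) (s : ℝ) : ℕ → ℕ → ℕ → ℝ
  | 0 => fun F j => if F = 0 then b j else 0
  | i + 1 => fun F j => (stage p fl s (table p fl b s i) j F).1

/-- The computed value at level `F`, superscript `k ≤ n` and index `j ≤ k`: `b̂_j^{(k)}` for
`F = 0` and `∂^F b̂_j^{(k)}` for `F ≥ 1`. -/
def computed (p : ℕ) (fl : ℝ → ℝ) (n : ℕ) (b : ℕ → ℝ) (s : ℝ) (F k j : ℕ) : ℝ :=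
  table p fl b s (n - k) F j

/-- The last level of the algorithm is evaluated without error-free transformations; this does
not change the computed value. -/
theorem stage_succ_fst (p : ℕ) (fl : ℝ → ℝ) (s : ℝ) (v : ℕ → ℕ → ℝ) (j F : ℕ) :
    (stage p fl s v j (F + 1)).1 =
      fl (fl (localError fl (stage p fl s v j F).2 (twoSum fl 1 (-s)).2 (v F j)
          + fl (s * v (F + 1) (j + 1)))
        + fl ((twoSum fl 1 (-s)).1 * v (F + 1) j)) := by
  have h : ∀ (l : List ℝ) (acc : ℝ),
      (sumEFT fl acc l).2 = l.foldl (fun acc x => fl (acc + x)) acc := by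
    intro l
    induction l with
    | nil => intro acc; rfl
    | cons x xs ih => intro acc; exact ih _
  simp [stage, localErrorEFT, localError, twoSum, twoProd, h]

/-! ### Exact values and global errors -/

/-- The exact de Casteljau values after `i` steps, i.e. with superscript `n - i`. -/
def exactTable (b : ℕ → ℝ) (s : ℝ) : ℕ → ℕ → ℝ
  | 0 => b
  | i + 1 => fun j => (1 - s) * exactTable b s i j + s * exactTable b s i (j + 1)

/-- The exact de Casteljau value `b_j^{(k)}`, for `k ≤ n` and `j ≤ k`. -/
def exact (n : ℕ) (b : ℕ → ℝ) (s : ℝ) (k j : ℕ) : ℝ := exactTable b s (n - k) j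

/-- The global error `∂^F b_j^{(k)}` of order `F`: `∂^0 b = b` is the exact value, and
`∂^{F+1} b` is the difference between `∂^F b` and its computed counterpart. -/
def globalError (p : ℕ) (fl : ℝ → ℝ) (n : ℕ) (b : ℕ → ℝ) (s : ℝ) : ℕ → ℕ → ℕ → ℝ
  | 0, k, j => exact n b s k j
  | F + 1, k, j => globalError p fl n b s F k j - computed p fl n b s F k j

/-- `p̃(s) = ∑_{j ≤ n} |b_j| B_{j,n}(s)`. -/
noncomputable def absBernsteinSum (n : ℕ) (b : ℕ → ℝ) (s : ℝ) : ℝ :=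
  ∑ j ∈ Finset.range (n + 1), |b j| * (bernsteinPolynomial ℝ n j).eval s

end KCompensated

namespace KCompensated

/-! ### Floating point numbers -/

theorem isFloat_zero (p : ℕ) : IsFloat p 0 := ⟨0, 0, by simp, by simp⟩

theorem isFloat_one {p : ℕ} (hp : 1 ≤ p) : IsFloat p 1 :=
  ⟨1, 0, by simpa using one_lt_pow₀ (one_lt_two (α := ℤ)) (by omega), by simp⟩

theorem IsFloat.neg {p : ℕ} {x : ℝ} (h : IsFloat p x) : IsFloat p (-x) := by
  obtain ⟨m, e, hm, rfl⟩ := h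
  exact ⟨-m, e, by rwa [abs_neg], by push_cast; ring⟩

theorem IsFloat.mul_zpow {p : ℕ} {x : ℝ} (h : IsFloat p x) (k : ℤ) :
    IsFloat p (x * (2 : ℝ) ^ k) := by
  obtain ⟨m, e, hm, rfl⟩ := h
  exact ⟨m, e + k, hm, by rw [zpow_add₀ two_ne_zero, mul_assoc]⟩

theorem isFloat_zpow {p : ℕ} (hp : 1 ≤ p) (k : ℤ) : IsFloat p ((2 : ℝ) ^ k) := by
  simpa using (isFloat_one hp).mul_zpow k

theorem isFloat_of_abs_le {p : ℕ} (hp : 1 ≤ p) {m : ℤ} (hm : |m| ≤ 2 ^ p) (e : ℤ) :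
    IsFloat p ((m : ℝ) * (2 : ℝ) ^ e) := by
  rcases hm.lt_or_eq with h | h
  · exact ⟨m, e, h, rfl⟩
  · refine IsFloat.mul_zpow ?_ e
    have h2 : IsFloat p ((2 : ℝ) ^ p) := by simpa using isFloat_zpow hp p
    rcases (abs_eq (by positivity)).1 h with h | h
    · rw [h]; push_cast; exact h2
    · rw [h]; push_cast; exact h2.neg

/-- A multiple of `2 ^ e` of absolute value at most `2 ^ (p + e)` is a float. -/
theorem isFloat_of_abs_mul_le {p : ℕ} (hp : 1 ≤ p) {x : ℝ} {m e : ℤ}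
    (hx : x = (m : ℝ) * (2 : ℝ) ^ e) (h : |x| ≤ 2 ^ p * (2 : ℝ) ^ e) : IsFloat p x := by
  have he : (0 : ℝ) < (2 : ℝ) ^ e := by positivity
  rw [hx]
  refine isFloat_of_abs_le hp ?_ e
  rw [hx, abs_mul, abs_of_pos he, mul_le_mul_iff_left₀ he] at h
  exact_mod_cast h

theorem exists_eq_mul_zpow_of_le {x : ℝ} {m e e' : ℤ} (hx : x = (m : ℝ) * (2 : ℝ) ^ e)
    (h : e' ≤ e) : ∃ m' : ℤ, x = (m' : ℝ) * (2 : ℝ) ^ e' := by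
  obtain ⟨k, rfl⟩ := Int.le.dest h
  refine ⟨m * 2 ^ k, ?_⟩
  rw [hx, zpow_add₀ two_ne_zero]
  push_cast
  rw [zpow_natCast]; ring

/-- A float of absolute value at least `2 ^ (p + e - 1)` is a multiple of `2 ^ e`. -/
theorem IsFloat.exists_eq_mul_zpow {p : ℕ} {y : ℝ} (h : IsFloat p y) {e : ℤ}
    (hy : 2 ^ p * (2 : ℝ) ^ e ≤ 2 * |y|) : ∃ m : ℤ, y = (m : ℝ) * (2 : ℝ) ^ e := by
  obtain ⟨m, e', hm, rfl⟩ := h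
  refine exists_eq_mul_zpow_of_le rfl ?_
  by_contra hlt
  have he' : (0 : ℝ) < (2 : ℝ) ^ e' := by positivity
  have hm' : |(m : ℝ)| < 2 ^ p := by exact_mod_cast hm
  have h1 : (2 : ℝ) ^ (e' + 1) ≤ (2 : ℝ) ^ e := zpow_le_zpow_right₀ (by norm_num) (by omega)
  rw [zpow_add₀ two_ne_zero, zpow_one] at h1
  rw [abs_mul, abs_of_pos he'] at hy
  have h2 : |(m : ℝ)| * (2 : ℝ) ^ e' < 2 ^ p * (2 : ℝ) ^ e' := by gcongr
  have h3 : (2 : ℝ) ^ p * ((2 : ℝ) ^ e' * 2) ≤ 2 ^ p * (2 : ℝ) ^ e := by gcongr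
  linarith

theorem IsFloat.exists_normalized {p : ℕ} {x : ℝ} (h : IsFloat p x) (hx : x ≠ 0) :
    ∃ m e : ℤ, x = (m : ℝ) * (2 : ℝ) ^ e ∧ |m| < 2 ^ p ∧ 2 ^ p ≤ 2 * |m| := by
  obtain ⟨k, hk1, hk2⟩ := exists_mem_Ico_zpow (abs_pos.2 hx) (one_lt_two (α := ℝ))
  have e1 : (2 : ℝ) ^ p * (2 : ℝ) ^ (k + 1 - p) = (2 : ℝ) ^ (k + 1) := by
    rw [← zpow_natCast, ← zpow_add₀ two_ne_zero]; congr 1; ring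
  have e2 : (2 : ℝ) ^ (k + 1) = 2 * (2 : ℝ) ^ k := by rw [zpow_add₀ two_ne_zero]; ring
  obtain ⟨m, hm⟩ := h.exists_eq_mul_zpow (e := k + 1 - p) (by rw [e1]; linarith)
  refine ⟨m, _, hm, ?_⟩
  have he : (0 : ℝ) < (2 : ℝ) ^ (k + 1 - p : ℤ) := by positivity
  rw [hm, abs_mul, abs_of_pos he] at hk1 hk2
  constructor
  · rw [← e1, mul_lt_mul_iff_left₀ he] at hk2
    exact_mod_cast hk2
  · have : (2 : ℝ) ^ p * (2 : ℝ) ^ (k + 1 - p) ≤ (2 * |(m : ℝ)|) * (2 : ℝ) ^ (k + 1 - p) := by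
      rw [e1]; linarith
    rw [mul_le_mul_iff_left₀ he] at this
    exact_mod_cast this

/-! ### Rounding to nearest -/

theorem IsRoundToNearest.fl_eq {p : ℕ} {fl : ℝ → ℝ} (H : IsRoundToNearest p fl) {x : ℝ}
    (hx : IsFloat p x) : fl x = x := by
  have := H.nearest x x hx
  rw [sub_self, abs_zero] at this
  exact (sub_eq_zero.1 (abs_nonpos_iff.1 this)).symm

theorem IsRoundToNearest.fl_zero {p : ℕ} {fl : ℝ → ℝ} (H : IsRoundToNearest p fl) : fl 0 = 0 :=
  H.fl_eq (isFloat_zero p)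

/-- Conjugation of a rounding to nearest by the multiplication with `± 2 ^ e`. -/
theorem IsRoundToNearest.conj {p : ℕ} {fl : ℝ → ℝ} (H : IsRoundToNearest p fl) {c : ℝ} {e : ℤ}
    (hc : c = (2 : ℝ) ^ e ∨ c = -(2 : ℝ) ^ e) : IsRoundToNearest p fun x => fl (c * x) / c := by
  have he : (0 : ℝ) < (2 : ℝ) ^ e := by positivity
  have hc0 : c ≠ 0 := by rcases hc with rfl | rfl <;> simp [he.ne']
  refine ⟨fun x => ?_, fun x y hy => ?_⟩
  · have := (H.isFloat (c * x)).mul_zpow (-e)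
    rw [zpow_neg, ← div_eq_mul_inv] at this
    rcases hc with rfl | rfl
    · exact this
    · rw [div_neg]; exact this.neg
  · have hcy : IsFloat p (c * y) := by
      rcases hc with rfl | rfl
      · rw [mul_comm]; exact hy.mul_zpow e
      · rw [neg_mul, mul_comm]; exact (hy.mul_zpow e).neg
    have := H.nearest (c * x) (c * y) hcy
    rw [← mul_sub, abs_mul] at this
    have h2 : c * x - fl (c * x) = c * (x - fl (c * x) / c) := by field_simp
    rw [h2, abs_mul] at this
    exact le_of_mul_le_mul_left this (abs_pos.2 hc0)

theorem IsRoundToNearest.zpow_le_abs {p : ℕ} {fl : ℝ → ℝ} (H : IsRoundToNearest p fl)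
    (hp : 1 ≤ p) {x : ℝ} {k : ℤ} (hx : (2 : ℝ) ^ k ≤ |x|) : (2 : ℝ) ^ k ≤ |fl x| := by
  rcases le_abs.1 hx with h | h
  · have h1 := H.nearest x _ (isFloat_zpow hp k)
    rw [abs_of_nonneg (sub_nonneg.2 h)] at h1
    exact le_abs.2 (Or.inl (by linarith [le_abs_self (x - fl x)]))
  · have h1 := H.nearest x _ (isFloat_zpow hp k).neg
    rw [abs_of_nonpos (show x - -(2 : ℝ) ^ k ≤ 0 by linarith)] at h1
    exact le_abs.2 (Or.inr (by linarith [neg_abs_le (x - fl x)]))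

theorem IsRoundToNearest.abs_sub_le {p : ℕ} {fl : ℝ → ℝ} (H : IsRoundToNearest p fl)
    (hp : 1 ≤ p) {x : ℝ} {e : ℤ} (hx : |x| ≤ 2 ^ p * (2 : ℝ) ^ e) :
    |x - fl x| ≤ (2 : ℝ) ^ e / 2 := by
  have he : (0 : ℝ) < (2 : ℝ) ^ e := by positivity
  have hy : |x / (2 : ℝ) ^ e| ≤ 2 ^ p := by
    rwa [abs_div, abs_of_pos he, div_le_iff₀ he]
  have hr : |round (x / (2 : ℝ) ^ e)| ≤ 2 ^ p := by
    have h1 := abs_sub_round (x / (2 : ℝ) ^ e)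
    have h2 : |((round (x / (2 : ℝ) ^ e) : ℤ) : ℝ)| < 2 ^ p + 1 := by
      have := abs_sub_abs_le_abs_sub ((round (x / (2 : ℝ) ^ e) : ℤ) : ℝ) (x / (2 : ℝ) ^ e)
      rw [abs_sub_comm] at this
      linarith
    have h3 : |round (x / (2 : ℝ) ^ e)| < 2 ^ p + 1 := by exact_mod_cast h2
    omega
  refine (H.nearest x _ (isFloat_of_abs_le hp hr e)).trans ?_
  have h1 := abs_sub_round (x / (2 : ℝ) ^ e)
  have h2 : x - (round (x / (2 : ℝ) ^ e) : ℤ) * (2 : ℝ) ^ e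
      = (x / (2 : ℝ) ^ e - (round (x / (2 : ℝ) ^ e) : ℤ)) * (2 : ℝ) ^ e := by field_simp
  rw [h2, abs_mul, abs_of_pos he]
  nlinarith

theorem IsRoundToNearest.abs_sub_le_mul {p : ℕ} {fl : ℝ → ℝ} (H : IsRoundToNearest p fl)
    (hp : 1 ≤ p) (x : ℝ) : |x - fl x| ≤ unitRoundoff p * |x| := by
  rcases eq_or_ne x 0 with rfl | hx
  · simp [H.fl_zero]
  obtain ⟨k, hk1, hk2⟩ := exists_mem_Ico_zpow (abs_pos.2 hx) (one_lt_two (α := ℝ))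
  have e1 : (2 : ℝ) ^ p * (2 : ℝ) ^ (k + 1 - p) = (2 : ℝ) ^ (k + 1) := by
    rw [← zpow_natCast, ← zpow_add₀ two_ne_zero]; congr 1; ring
  have e2 : (2 : ℝ) ^ (k + 1) = 2 * (2 : ℝ) ^ k := by rw [zpow_add₀ two_ne_zero]; ring
  refine (H.abs_sub_le hp (e := k + 1 - p) (by rw [e1]; exact hk2.le)).trans ?_
  have e3 : (2 : ℝ) ^ (k + 1 - p) = unitRoundoff p * (2 * (2 : ℝ) ^ k) := by
    rw [← e2, ← e1, unitRoundoff, ← mul_assoc, ← mul_pow]; norm_num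
  rw [e3]
  have : 0 ≤ unitRoundoff p := by unfold unitRoundoff; positivity
  nlinarith

/-- Rounding a multiple of `2 ^ e` gives a multiple of `2 ^ e`, and even one of `2 ^ (e + 1)`
when the rounding is not exact. -/
theorem IsRoundToNearest.fl_eq_or {p : ℕ} {fl : ℝ → ℝ} (H : IsRoundToNearest p fl)
    (hp : 1 ≤ p) {x : ℝ} {m e : ℤ} (hx : x = (m : ℝ) * (2 : ℝ) ^ e) :
    fl x = x ∨ ∃ m' : ℤ, fl x = (m' : ℝ) * (2 : ℝ) ^ (e + 1) := by
  rcases le_total |x| (2 ^ p * (2 : ℝ) ^ e) with h | h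
  · exact Or.inl (H.fl_eq (isFloat_of_abs_mul_le hp hx h))
  · refine Or.inr ((H.isFloat x).exists_eq_mul_zpow ?_)
    rw [← zpow_natCast, ← zpow_add₀ two_ne_zero] at h
    have := H.zpow_le_abs hp h
    rw [zpow_add₀ two_ne_zero, zpow_natCast] at this
    rw [zpow_add₀ two_ne_zero]
    linarith

theorem IsRoundToNearest.exists_fl_eq_mul_zpow {p : ℕ} {fl : ℝ → ℝ} (H : IsRoundToNearest p fl)
    (hp : 1 ≤ p) {x : ℝ} {m e : ℤ} (hx : x = (m : ℝ) * (2 : ℝ) ^ e) :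
    ∃ m' : ℤ, fl x = (m' : ℝ) * (2 : ℝ) ^ e := by
  rcases H.fl_eq_or hp hx with h | ⟨m', h⟩
  · exact ⟨m, h.trans hx⟩
  · exact exists_eq_mul_zpow_of_le h (by omega)

/-! ### Exactness of `TwoSum` -/

/-- The error of a floating point addition is a float. -/
theorem IsRoundToNearest.isFloat_add_sub {p : ℕ} {fl : ℝ → ℝ} (H : IsRoundToNearest p fl)
    (hp : 1 ≤ p) {a b : ℝ} {k m e : ℤ} (haf : IsFloat p a) (ha : a = (k : ℝ) * (2 : ℝ) ^ e)
    (hb : b = (m : ℝ) * (2 : ℝ) ^ e) (hm : |m| < 2 ^ p) : IsFloat p (a + b - fl (a + b)) := by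
  have hab : a + b = ((k + m : ℤ) : ℝ) * (2 : ℝ) ^ e := by rw [ha, hb]; push_cast; ring
  obtain ⟨m', hm'⟩ := H.exists_fl_eq_mul_zpow hp hab
  refine isFloat_of_abs_mul_le hp (m := k + m - m') (e := e) ?_ ?_
  · rw [hm', hab]; push_cast; ring
  · refine (H.nearest (a + b) a haf).trans ?_
    rw [add_sub_cancel_left, hb, abs_mul, abs_of_pos (show (0 : ℝ) < (2 : ℝ) ^ e by positivity)]
    gcongr
    exact_mod_cast hm.le

/-- If `b` is a float `m * 2 ^ e` and `a` is a float and a multiple of `2 ^ e`, then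
`(a ⊕ b) - a` is a float. -/
theorem IsRoundToNearest.isFloat_fl_add_sub {p : ℕ} {fl : ℝ → ℝ} (H : IsRoundToNearest p fl)
    (hp : 1 ≤ p) {a b : ℝ} {k m e : ℤ} (haf : IsFloat p a) (ha : a = (k : ℝ) * (2 : ℝ) ^ e)
    (hb : b = (m : ℝ) * (2 : ℝ) ^ e) (hm : |m| < 2 ^ p) : IsFloat p (fl (a + b) - a) := by
  have he : (0 : ℝ) < (2 : ℝ) ^ e := by positivity
  have e1 : (2 : ℝ) ^ (e + 1) = 2 * (2 : ℝ) ^ e := by rw [zpow_add₀ two_ne_zero]; ring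
  have hab : a + b = ((k + m : ℤ) : ℝ) * (2 : ℝ) ^ e := by rw [ha, hb]; push_cast; ring
  have hm1 : |(m : ℝ)| + 1 ≤ 2 ^ p := by exact_mod_cast hm
  have hb' : |b| + (2 : ℝ) ^ e ≤ 2 ^ p * (2 : ℝ) ^ e := by
    rw [hb, abs_mul, abs_of_pos he]; nlinarith
  rcases H.fl_eq_or hp hab with h | ⟨m', h⟩
  · rw [h, add_sub_cancel_left]; exact ⟨m, e, hm, hb⟩
  have hS := H.nearest (a + b) a haf
  rw [add_sub_cancel_left] at hS
  have tri : |fl (a + b) - a| ≤ |b| + |a + b - fl (a + b)| := by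
    calc |fl (a + b) - a| = |b - (a + b - fl (a + b))| := by congr 1; ring
      _ ≤ _ := abs_sub _ _
  rcases Int.even_or_odd' k with ⟨l, rfl | rfl⟩
  · refine isFloat_of_abs_mul_le hp (m := m' - l) (e := e + 1) ?_ ?_
    · rw [h, ha, e1]; push_cast; ring
    · rw [e1]; linarith
  · have ha' : |a| ≤ 2 ^ p * (2 : ℝ) ^ e := by
      by_contra! hlt
      obtain ⟨l', hl'⟩ := haf.exists_eq_mul_zpow (e := e + 1) (by rw [e1]; linarith)
      rw [ha, e1, ← mul_assoc, mul_left_inj' he.ne'] at hl'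
      have : (2 * l + 1 : ℤ) = l' * 2 := by exact_mod_cast hl'
      omega
    have hS' := H.abs_sub_le hp (x := a + b) (e := e + 1)
      (by rw [e1]; linarith [abs_add_le a b])
    rw [e1] at hS'
    refine isFloat_of_abs_mul_le hp (m := m' * 2 - (2 * l + 1)) (e := e) ?_ (by linarith)
    rw [h, ha, e1]; push_cast; ring

theorem IsRoundToNearest.twoSum_snd {p : ℕ} {fl : ℝ → ℝ} (H : IsRoundToNearest p fl)
    (hp : 1 ≤ p) {a b : ℝ} (ha : IsFloat p a) (hb : IsFloat p b) :
    (twoSum fl a b).2 = a + b - (twoSum fl a b).1 := by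
  obtain ⟨m, e, hm, hm'⟩ := id ha
  obtain ⟨k, f, hk, hk'⟩ := id hb
  simp only [twoSum]
  rcases le_total f e with hfe | hfe
  · obtain ⟨m₁, hm₁⟩ := exists_eq_mul_zpow_of_le hm' hfe
    have hz : fl (fl (a + b) - a) = fl (a + b) - a :=
      H.fl_eq (H.isFloat_fl_add_sub hp ha hm₁ hk' hk)
    have hδ := H.fl_eq (H.isFloat_add_sub hp ha hm₁ hk' hk)
    rw [hz, sub_sub_cancel, H.fl_eq ha, sub_self, H.fl_zero, zero_add,
      show b - (fl (a + b) - a) = a + b - fl (a + b) by ring, hδ, hδ]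
  · obtain ⟨k₁, hk₁⟩ := exists_eq_mul_zpow_of_le hk' hfe
    have hab : a + b = ((m + k₁ : ℤ) : ℝ) * (2 : ℝ) ^ e := by
      rw [hm', hk₁]; push_cast; ring
    have hδ : IsFloat p (a + b - fl (a + b)) := by
      have := H.isFloat_add_sub hp hb hk₁ hm' hm
      rwa [add_comm b a] at this
    have hS := H.isFloat (a + b)
    obtain ⟨S', hS'⟩ := H.exists_fl_eq_mul_zpow hp hab
    set S := fl (a + b)
    have hma : -a = ((-m : ℤ) : ℝ) * (2 : ℝ) ^ e := by rw [hm']; push_cast; ring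
    have hmn : |-m| < 2 ^ p := by rwa [abs_neg]
    have h1 := H.isFloat_fl_add_sub hp hS hS' hma hmn
    have h2 := H.isFloat_add_sub hp hS hS' hma hmn
    rw [← sub_eq_add_neg] at h1 h2
    have hδ' : |a + b - S| ≤ |a| := by
      have := H.nearest (a + b) b hb
      rwa [add_sub_cancel_right] at this
    have hδm : -(a + b - S) = ((S' - m - k₁ : ℤ) : ℝ) * (2 : ℝ) ^ e := by
      rw [hS', hab]; push_cast; ring
    have hδl : |S' - m - k₁| < 2 ^ p := by
      have he : (0 : ℝ) < (2 : ℝ) ^ e := by positivity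
      rw [← abs_neg, hδm, hm', abs_mul, abs_mul, mul_le_mul_iff_left₀ (abs_pos.2 he.ne')] at hδ'
      exact lt_of_le_of_lt (by exact_mod_cast hδ') hm
    have h3 := H.isFloat_fl_add_sub hp hb hk₁ hδm hδl
    rw [show b + -(a + b - S) = S - a by ring] at h3
    set z := fl (S - a)
    have h4 : fl (S - z) = S - z := H.fl_eq (by simpa using h1.neg)
    have h5 : fl (b - z) = b - z := H.fl_eq (by simpa using h3.neg)
    have h6 : fl (a - (S - z)) = a - (S - z) :=
      H.fl_eq (by have := h2.neg; rwa [show -(S - a - z) = a - (S - z) by ring] at this)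
    rw [h4, h5, h6, show a - (S - z) + (b - z) = a + b - S by ring]
    exact H.fl_eq hδ

/-! ### Exactness of `TwoProd` -/

theorem IsRoundToNearest.fl_intCast {p : ℕ} {fl : ℝ → ℝ} (H : IsRoundToNearest p fl)
    (hp : 1 ≤ p) (m : ℤ) (k : ℕ) (hm : |m| ≤ 2 ^ p) : fl (m * 2 ^ k) = m * 2 ^ k := by
  have := H.fl_eq (isFloat_of_abs_le hp hm k)
  rwa [zpow_natCast] at this

theorem IsRoundToNearest.exists_int {p : ℕ} {fl : ℝ → ℝ} (H : IsRoundToNearest p fl)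
    (hp : 1 ≤ p) {x : ℝ} {k : ℕ} (hx : 2 ^ (p + k) ≤ 2 * |x|) :
    ∃ m : ℤ, fl x = m * 2 ^ k := by
  obtain ⟨m, hm⟩ := (H.isFloat x).exists_eq_mul_zpow (e := k) (by
    have := H.zpow_le_abs hp (x := x) (k := (p + k : ℕ) - 1) (by
      rw [zpow_sub_one₀ two_ne_zero, zpow_natCast]; linarith)
    rw [zpow_sub_one₀ two_ne_zero, zpow_natCast, pow_add] at this
    rw [zpow_natCast]; linarith)
  exact ⟨m, by rwa [zpow_natCast] at hm⟩

theorem IsRoundToNearest.abs_sub_le_pow {p : ℕ} {fl : ℝ → ℝ} (H : IsRoundToNearest p fl)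
    (hp : 1 ≤ p) {x : ℝ} {k : ℕ} (hx : |x| ≤ 2 ^ (p + k)) : |x - fl x| ≤ 2 ^ k / 2 := by
  have := H.abs_sub_le hp (x := x) (e := k) (by rwa [zpow_natCast, ← pow_add])
  rwa [zpow_natCast] at this

theorem split_conj (p : ℕ) (fl : ℝ → ℝ) {c : ℝ} (hc : c ≠ 0) (a : ℝ) :
    split p fl (c * a) = (c * (split p (fun x => fl (c * x) / c) a).1,
      c * (split p (fun x => fl (c * x) / c) a).2) := by
  have h : ∀ x, c * (fl x / c) = fl x := fun x => by field_simp
  simp only [split, mul_sub, h, ← mul_assoc]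

/-- Veltkamp's splitting of an integer with exactly `p` bits. -/
theorem IsRoundToNearest.split_intCast {p : ℕ} {fl : ℝ → ℝ} (H : IsRoundToNearest p fl)
    (hp : 2 ≤ p) {m : ℤ} (hm1 : 2 ^ p ≤ 2 * m) (hm2 : m < 2 ^ p) :
    ∃ h l : ℤ, split p fl m = ((h : ℝ) * 2 ^ ((p + 1) / 2), (l : ℝ)) ∧
      m = h * 2 ^ ((p + 1) / 2) + l ∧ 2 * |l| ≤ 2 ^ ((p + 1) / 2) := by
  set r := (p + 1) / 2 with hr
  have hr1 : 1 ≤ r := by omega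
  have hrp : r + 1 ≤ p := by omega
  have hpr : (2 : ℝ) ^ (p + r) = 2 ^ p * 2 ^ r := pow_add _ _ _
  have hpr1 : (2 : ℝ) ^ (p + (r + 1)) = 2 * (2 ^ p * 2 ^ r) := by rw [← add_assoc, pow_succ, hpr]; ring
  have hR : (2 : ℝ) ≤ 2 ^ r := by simpa using pow_le_pow_right₀ (one_le_two (α := ℝ)) hr1
  have hRP : 2 * (2 : ℝ) ^ r ≤ 2 ^ p := by
    have := pow_le_pow_right₀ (one_le_two (α := ℝ)) hrp
    rw [pow_succ] at this; linarith
  have hm1' : (2 : ℝ) ^ p ≤ 2 * m := by exact_mod_cast hm1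
  have hm2' : (m : ℝ) + 1 ≤ 2 ^ p := by exact_mod_cast hm2
  have hRI : (2 : ℤ) ≤ 2 ^ r := by exact_mod_cast hR
  have hRPI : 2 * (2 : ℤ) ^ r ≤ 2 ^ p := by exact_mod_cast hRP
  set R : ℝ := 2 ^ r with hRdef
  set P : ℝ := 2 ^ p with hPdef
  have hm0 : (0 : ℝ) < m := by linarith
  set z := fl (m * (R + 1)) with hz
  -- `z` and `z - m`
  have key : (∃ k : ℤ, z = k * R) ∧ P * R ≤ 2 * (z - m) ∧ z - m ≤ P * R := by
    have habs : |(m : ℝ) * (R + 1)| = m * (R + 1) := abs_of_nonneg (by positivity)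
    rcases le_or_gt ((m : ℝ) * (R + 1)) (P * R) with hle | hgt
    · have h1 : P * R ≤ 2 * ((m : ℝ) * (R + 1)) := by nlinarith
      refine ⟨H.exists_int (by omega) (by rw [habs, hpr]; exact h1), ?_⟩
      have h2 := H.abs_sub_le_pow (by omega) (x := m * (R + 1)) (k := r)
        (by rw [habs, hpr]; exact hle)
      rw [← hz, ← hRdef] at h2
      have hz2 : z ≤ P * R := by
        have h3 := H.nearest (m * (R + 1)) (P * R)
          (by have := isFloat_zpow (p := p) (by omega) ((p + r : ℕ) : ℤ)
              rwa [zpow_natCast, hpr] at this)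
        rw [abs_sub_comm _ (P * R), abs_of_nonneg (sub_nonneg.2 hle)] at h3
        linarith [neg_abs_le (m * (R + 1) - fl (m * (R + 1)))]
      refine ⟨?_, by linarith⟩
      rcases hm1'.lt_or_eq with hlt | heq
      · have hlt' : P + 2 ≤ 2 * (m : ℝ) := by
          have : 2 ^ p < 2 * m := by rw [hPdef] at hlt; exact_mod_cast hlt
          have h2p : (2 : ℤ) ^ p = 2 * 2 ^ (p - 1) := by
            rw [← pow_succ']; congr 1; omega
          have : 2 ^ p + 2 ≤ 2 * m := by omega
          rw [hPdef]; exact_mod_cast this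
        nlinarith [le_abs_self (m * (R + 1) - z)]
      · have hfl : z = m * (R + 1) := by
          have hP' : (m : ℝ) = 2 ^ (p - 1) := by
            have : P = 2 ^ (p - 1) * 2 := by rw [← pow_succ, hPdef]; congr 1; omega
            linarith
          have := H.fl_intCast (by omega) (2 ^ r + 1) (p - 1) (by
            rw [abs_of_nonneg (by positivity)]
            omega)
          push_cast at this
          rw [← hRdef, ← hP', mul_comm] at this
          exact this
        rw [hfl]; nlinarith
    · have h1 : P * R ≤ |(m : ℝ) * (R + 1)| := by rw [habs]; exact hgt.le
      obtain ⟨k, hk⟩ := H.exists_int (p := p) (by omega) (x := m * (R + 1)) (k := r + 1)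
        (by rw [hpr1]; linarith)
      have hz1 : P * R ≤ z := by
        have h3 := H.nearest (m * (R + 1)) (P * R)
          (by have := isFloat_zpow (p := p) (by omega) ((p + r : ℕ) : ℤ)
              rwa [zpow_natCast, hpr] at this)
        rw [abs_of_nonneg (sub_nonneg.2 hgt.le)] at h3
        linarith [le_abs_self (m * (R + 1) - fl (m * (R + 1)))]
      have h2 := H.abs_sub_le_pow (by omega) (x := m * (R + 1)) (k := r + 1)
        (by rw [habs, hpr1]; nlinarith)
      rw [← hz, pow_succ, ← hRdef] at h2
      refine ⟨⟨k * 2, by rw [hz, hk, pow_succ]; push_cast; ring⟩, by nlinarith, ?_⟩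
      nlinarith [neg_abs_le (m * (R + 1) - z)]
  obtain ⟨⟨k, hk⟩, hzm1, hzm2⟩ := key
  have hzm0 : |z - m| = z - m := abs_of_nonneg (by nlinarith)
  set y := fl (z - m) with hy
  obtain ⟨j, hj⟩ := H.exists_int (p := p) (by omega) (x := z - m) (k := r)
    (by rw [hpr, hzm0]; exact hzm1)
  have hε := H.abs_sub_le_pow (by omega) (x := z - m) (k := r) (by rw [hpr, hzm0]; exact hzm2)
  rw [← hy, ← hRdef] at hε
  rw [← hy, ← hRdef] at hj
  have hzy : z - y = ((k - j : ℤ) : ℝ) * R := by rw [hk, hj]; push_cast; ring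
  have hε' := abs_le.1 hε
  have hflh : fl (z - y) = ((k - j : ℤ) : ℝ) * R := by
    rw [hzy]
    refine H.fl_intCast (by omega) _ _ ?_
    have h1 : |((k - j : ℤ) : ℝ) * R| ≤ P * R := by
      rw [← hzy, abs_le]; constructor <;> nlinarith
    rw [abs_mul, abs_of_pos (show 0 < R by linarith),
      mul_le_mul_iff_left₀ (show 0 < R by linarith)] at h1
    rw [hPdef] at h1; exact_mod_cast h1
  have hl : ((m - (k - j) * 2 ^ r : ℤ) : ℝ) = m - (z - y) := by rw [hzy]; push_cast; ring
  have hl2 : 2 * |(m - (k - j) * 2 ^ r : ℤ)| ≤ 2 ^ r := by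
    have : 2 * |((m - (k - j) * 2 ^ r : ℤ) : ℝ)| ≤ R := by
      rw [hl, show (m : ℝ) - (z - y) = -(z - m - y) by ring, abs_neg]; linarith
    rw [hRdef] at this; exact_mod_cast this
  refine ⟨k - j, m - (k - j) * 2 ^ r, ?_, by ring, hl2⟩
  simp only [split]
  rw [← hr, ← hRdef, ← hz, ← hy, hflh, hl, ← hzy]
  congr 1
  rw [← hl]
  have := H.fl_intCast (by omega) (m - (k - j) * 2 ^ r) 0 (by
    have := abs_nonneg (m - (k - j) * 2 ^ r : ℤ)
    omega)
  simpa using this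

/-- Splitting of a nonzero float: up to a scaling factor `c`, the high part is `h * 2 ^ r` and the
low part is `l`. -/
theorem IsRoundToNearest.exists_split {p : ℕ} {fl : ℝ → ℝ} (H : IsRoundToNearest p fl)
    (hp : 2 ≤ p) {a : ℝ} (ha : IsFloat p a) (ha0 : a ≠ 0) :
    ∃ (c : ℝ) (e m h l : ℤ), (c = (2 : ℝ) ^ e ∨ c = -(2 : ℝ) ^ e) ∧ a = c * m ∧
      2 ^ p ≤ 2 * m ∧ m < 2 ^ p ∧ split p fl a = (c * (h * 2 ^ ((p + 1) / 2)), c * l) ∧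
      m = h * 2 ^ ((p + 1) / 2) + l ∧ 2 * |l| ≤ 2 ^ ((p + 1) / 2) := by
  obtain ⟨m, e, rfl, hm1, hm2⟩ := ha.exists_normalized ha0
  have he : (0 : ℝ) < (2 : ℝ) ^ e := by positivity
  have : ∃ c : ℝ, (c = (2 : ℝ) ^ e ∨ c = -(2 : ℝ) ^ e) ∧
      (m : ℝ) * (2 : ℝ) ^ e = c * ((|m| : ℤ) : ℝ) := by
    rcases abs_choice m with h | h
    · exact ⟨_, Or.inl rfl, by rw [h]; ring⟩
    · exact ⟨_, Or.inr rfl, by rw [h]; push_cast; ring⟩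
  obtain ⟨c, hc, hcm⟩ := this
  have hc0 : c ≠ 0 := by rcases hc with rfl | rfl <;> simp [he.ne']
  obtain ⟨h, l, hs, hml, hl⟩ := (H.conj hc).split_intCast hp hm2 hm1
  refine ⟨c, e, |m|, h, l, hc, hcm, hm2, hm1, ?_, hml, hl⟩
  rw [hcm, split_conj p fl hc0, hs]

theorem IsRoundToNearest.split_zero {p : ℕ} {fl : ℝ → ℝ} (H : IsRoundToNearest p fl) :
    split p fl 0 = (0, 0) := by
  simp [split, H.fl_zero]

theorem IsRoundToNearest.fl_eq_of_pow {p : ℕ} {fl : ℝ → ℝ} (H : IsRoundToNearest p fl)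
    (hp : 1 ≤ p) {x : ℝ} {m : ℤ} {k : ℕ} (hx : x = m * 2 ^ k) (h : |x| ≤ 2 ^ p * 2 ^ k) :
    fl x = x :=
  H.fl_eq (isFloat_of_abs_mul_le hp (m := m) (e := k) (by rw [zpow_natCast, hx])
    (by rwa [zpow_natCast]))

theorem abs_high_part_le {p r : ℕ} (hr : r ≤ p) {a h l : ℤ} (ha1 : 0 ≤ a) (ha2 : a < 2 ^ p)
    (ha : a = h * 2 ^ r + l) (hl : 2 * |l| ≤ 2 ^ r) : |h| ≤ 2 ^ (p - r) := by
  have h1 : (2 : ℤ) ^ p = 2 ^ (p - r) * 2 ^ r := by rw [← pow_add]; congr 1; omega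
  have hR : (0 : ℤ) < 2 ^ r := by positivity
  have hT : (0 : ℤ) < 2 ^ (p - r) := by positivity
  have hl' := abs_le.1 (show |l| ≤ 2 ^ r / 2 by omega)
  have hl3 : 2 * (2 ^ r / 2) ≤ (2 : ℤ) ^ r := by omega
  rw [abs_le]
  constructor
  · by_contra! hc
    nlinarith
  · by_contra! hc
    nlinarith

set_option maxHeartbeats 1000000 in
/-- Dekker's product of integers with exactly `p` bits. -/
theorem IsRoundToNearest.dekker_int {p : ℕ} {fl : ℝ → ℝ} (H : IsRoundToNearest p fl)
    (hp : 4 ≤ p) {r : ℕ} (hr : r = (p + 1) / 2) {a b h k l q : ℤ}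
    (ha1 : 2 ^ p ≤ 2 * a) (ha2 : a < 2 ^ p) (hb1 : 2 ^ p ≤ 2 * b) (hb2 : b < 2 ^ p)
    (ha : a = h * 2 ^ r + l) (hb : b = k * 2 ^ r + q)
    (hl : 2 * |l| ≤ 2 ^ r) (hq : 2 * |q| ≤ 2 ^ r) :
    fl (fl ((l : ℝ) * q) - fl (fl (fl (fl ((a : ℝ) * b) - fl ((h * 2 ^ r : ℝ) * (k * 2 ^ r)))
      - fl ((l : ℝ) * (k * 2 ^ r))) - fl ((h * 2 ^ r : ℝ) * q))) = a * b - fl ((a : ℝ) * b) := by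
  have hp1 : 1 ≤ p := by omega
  have hP0 : (0 : ℤ) < 2 ^ p := by positivity
  have hh : |(h : ℝ)| ≤ 2 ^ (p - r) := by
    exact_mod_cast abs_high_part_le (by omega) (by omega) ha2 ha hl
  have hk : |(k : ℝ)| ≤ 2 ^ (p - r) := by
    exact_mod_cast abs_high_part_le (by omega) (by omega) hb2 hb hq
  have hl' : 2 * |(l : ℝ)| ≤ 2 ^ r := by exact_mod_cast hl
  have hq' : 2 * |(q : ℝ)| ≤ 2 ^ r := by exact_mod_cast hq
  have hP : (2 : ℝ) ^ p = 2 ^ (p - r) * 2 ^ r := by rw [← pow_add]; congr 1; omega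
  have hTR : (2 : ℝ) ^ (p - r) ≤ 2 ^ r := pow_le_pow_right₀ one_le_two (by omega)
  have hRT : (2 : ℝ) ^ r ≤ 2 * 2 ^ (p - r) := by
    rw [← pow_succ']; exact pow_le_pow_right₀ one_le_two (by omega)
  have hRP : 4 * (2 : ℝ) ^ r ≤ 2 ^ p := by
    rw [show (4 : ℝ) = 2 ^ 2 by norm_num, ← pow_add]
    exact pow_le_pow_right₀ one_le_two (by omega)
  have hR4 : (4 : ℝ) ≤ 2 ^ r := by
    rw [show (4 : ℝ) = 2 ^ 2 by norm_num]
    exact pow_le_pow_right₀ one_le_two (by omega)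
  have ha1' : (2 : ℝ) ^ p ≤ 2 * a := by exact_mod_cast ha1
  have hb1' : (2 : ℝ) ^ p ≤ 2 * b := by exact_mod_cast hb1
  have ha2' : (a : ℝ) ≤ 2 ^ p := by exact_mod_cast ha2.le
  have hb2' : (b : ℝ) ≤ 2 ^ p := by exact_mod_cast hb2.le
  have haR : (a : ℝ) = h * 2 ^ r + l := by exact_mod_cast ha
  have hbR : (b : ℝ) = k * 2 ^ r + q := by exact_mod_cast hb
  have hPpos : (0 : ℝ) < 2 ^ p := by positivity
  have hTpos : (0 : ℝ) < 2 ^ (p - r) := by positivity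
  have habs : |(a : ℝ) * b| = a * b := abs_of_nonneg (mul_nonneg (by linarith) (by linarith))
  have hhk : |(h : ℝ) * k| ≤ 2 ^ p := by
    rw [abs_mul, hP]
    exact mul_le_mul hh (hk.trans hTR) (abs_nonneg _) hTpos.le
  have hlk : 2 * |(l : ℝ) * k| ≤ 2 ^ p := by
    rw [abs_mul, ← mul_assoc, hP, mul_comm (2 ^ (p - r))]
    exact mul_le_mul hl' hk (abs_nonneg _) (by positivity)
  have hhq : 2 * |(h : ℝ) * q| ≤ 2 ^ p := by
    rw [abs_mul, mul_left_comm, hP]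
    exact mul_le_mul hh hq' (by positivity) (by positivity)
  have hlq : 2 * |(l : ℝ) * q| ≤ 2 ^ p := by
    rw [abs_mul, hP]
    have := mul_le_mul hl' hq' (by positivity) (by positivity)
    nlinarith
  -- the products of the parts
  have e1 : fl ((h * 2 ^ r : ℝ) * (k * 2 ^ r)) = (h * 2 ^ r : ℝ) * (k * 2 ^ r) := by
    refine H.fl_eq_of_pow hp1 (m := h * k) (k := r + r) (by push_cast; ring) ?_
    rw [show (h * 2 ^ r : ℝ) * (k * 2 ^ r) = (h * k) * 2 ^ (r + r) by ring, abs_mul,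
      abs_of_pos (show (0 : ℝ) < 2 ^ (r + r) by positivity)]
    gcongr
  have e2 : fl ((l : ℝ) * (k * 2 ^ r)) = (l : ℝ) * (k * 2 ^ r) := by
    refine H.fl_eq_of_pow hp1 (m := l * k) (k := r) (by push_cast; ring) ?_
    rw [← mul_assoc, abs_mul, abs_of_pos (show (0 : ℝ) < 2 ^ r by positivity)]
    gcongr; linarith [abs_nonneg ((l : ℝ) * k)]
  have e3 : fl ((h * 2 ^ r : ℝ) * q) = (h * 2 ^ r : ℝ) * q := by
    refine H.fl_eq_of_pow hp1 (m := h * q) (k := r) (by push_cast; ring) ?_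
    rw [mul_right_comm, abs_mul, abs_of_pos (show (0 : ℝ) < 2 ^ r by positivity)]
    gcongr; linarith [abs_nonneg ((h : ℝ) * q)]
  have e4 : fl ((l : ℝ) * q) = (l : ℝ) * q := by
    refine H.fl_eq_of_pow hp1 (m := l * q) (k := 0) (by push_cast; ring) ?_
    linarith [abs_nonneg ((l : ℝ) * q)]
  rw [e1, e2, e3, e4]
  -- the rounded product
  obtain ⟨m, hm⟩ := H.exists_int (p := p) hp1 (x := (a : ℝ) * b) (k := p - 1) (by
    have : (2 : ℝ) ^ (p + (p - 1)) * 2 = 2 ^ p * 2 ^ p := by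
      rw [← pow_succ, ← pow_add]; congr 1; omega
    rw [habs]; nlinarith)
  have hπ := H.abs_sub_le_pow hp1 (x := (a : ℝ) * b) (k := p) (by
    rw [habs, pow_add]
    exact mul_le_mul ha2' hb2' (by linarith) hPpos.le)
  have hm2 : (2 : ℝ) ^ (p - 1) = 2 ^ (p - 1 - r) * 2 ^ r := by rw [← pow_add]; congr 1; omega
  set S := fl ((a : ℝ) * b) with hS
  have hRq : |(h : ℝ) * q * 2 ^ r| = |(h : ℝ) * q| * 2 ^ r := by
    rw [abs_mul, abs_of_pos (show (0 : ℝ) < 2 ^ r by positivity)]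
  have hRk : |(l : ℝ) * k * 2 ^ r| = |(l : ℝ) * k| * 2 ^ r := by
    rw [abs_mul, abs_of_pos (show (0 : ℝ) < 2 ^ r by positivity)]
  have hRq' := abs_le.1 (hRq.trans_le (mul_le_mul_of_nonneg_right (show |(h : ℝ) * q| ≤ 2 ^ p / 2 by
    linarith) (by positivity)))
  have hRk' := abs_le.1 (hRk.trans_le (mul_le_mul_of_nonneg_right (show |(l : ℝ) * k| ≤ 2 ^ p / 2 by
    linarith) (by positivity)))
  have hlq' := abs_le.1 (show |(l : ℝ) * q| ≤ 2 ^ p / 2 by linarith)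
  have hπ' := abs_le.1 hπ
  have hab : (a : ℝ) * b = (h * 2 ^ r : ℝ) * (k * 2 ^ r) + h * q * 2 ^ r + l * k * 2 ^ r + l * q := by
    rw [haR, hbR]; ring
  have hPR : 4 * (2 : ℝ) ^ p ≤ 2 ^ p * 2 ^ r := by nlinarith
  have e5 : fl (S - (h * 2 ^ r : ℝ) * (k * 2 ^ r)) = S - (h * 2 ^ r : ℝ) * (k * 2 ^ r) := by
    refine H.fl_eq_of_pow hp1 (m := m - h * k * 2 ^ (r + r - (p - 1))) (k := p - 1) ?_ ?_
    · have : (2 : ℝ) ^ (r + r) = 2 ^ (r + r - (p - 1)) * 2 ^ (p - 1) := by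
        rw [← pow_add]; congr 1; omega
      rw [hm]; push_cast
      rw [sub_mul, mul_assoc (h * k : ℝ), ← this]; ring
    · have h2 : 2 * (2 : ℝ) ^ (p - 1) = 2 ^ p := by rw [← pow_succ']; congr 1; omega
      have h3 : 2 * ((2 : ℝ) ^ p * 2 ^ (p - 1)) = 2 ^ p * 2 ^ p := by rw [← h2]; ring
      have h4 : (2 : ℝ) ^ p * (4 * 2 ^ r) ≤ 2 ^ p * 2 ^ p := by gcongr
      rw [abs_le]; constructor <;> linarith
  rw [e5]
  have e6 : fl (S - (h * 2 ^ r : ℝ) * (k * 2 ^ r) - l * (k * 2 ^ r)) =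
      S - (h * 2 ^ r : ℝ) * (k * 2 ^ r) - l * (k * 2 ^ r) := by
    refine H.fl_eq_of_pow hp1 (m := m * 2 ^ (p - 1 - r) - h * k * 2 ^ r - l * k) (k := r) ?_ ?_
    · rw [hm, hm2]; push_cast; ring
    · rw [abs_le]; constructor <;> linarith
  rw [e6]
  have e7 : fl (S - (h * 2 ^ r : ℝ) * (k * 2 ^ r) - l * (k * 2 ^ r) - h * 2 ^ r * q) =
      S - (h * 2 ^ r : ℝ) * (k * 2 ^ r) - l * (k * 2 ^ r) - h * 2 ^ r * q := by
    refine H.fl_eq_of_pow hp1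
      (m := m * 2 ^ (p - 1) - h * 2 ^ r * (k * 2 ^ r) - l * (k * 2 ^ r) - h * 2 ^ r * q)
      (k := 0) ?_ ?_
    · rw [hm]; push_cast; ring
    · rw [pow_zero, mul_one, abs_le]; constructor <;> linarith
  rw [e7]
  have e8 : (l : ℝ) * q - (S - (h * 2 ^ r : ℝ) * (k * 2 ^ r) - l * (k * 2 ^ r) - h * 2 ^ r * q) =
      a * b - S := by rw [hab]; ring
  rw [e8]
  refine H.fl_eq_of_pow hp1 (m := a * b - m * 2 ^ (p - 1)) (k := 0) ?_ ?_
  · rw [hm]; push_cast; ring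
  · linarith

theorem IsRoundToNearest.twoProd_snd {p : ℕ} {fl : ℝ → ℝ} (H : IsRoundToNearest p fl)
    (hp : 4 ≤ p) {a b : ℝ} (ha : IsFloat p a) (hb : IsFloat p b) :
    (twoProd p fl a b).2 = a * b - (twoProd p fl a b).1 := by
  rcases eq_or_ne a 0 with rfl | ha0
  · simp [twoProd, H.split_zero, H.fl_zero]
  rcases eq_or_ne b 0 with rfl | hb0
  · simp [twoProd, H.split_zero, H.fl_zero]
  obtain ⟨c, e, m, h, l, hc, rfl, hm1, hm2, hsa, hml, hl⟩ := H.exists_split (by omega) ha ha0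
  obtain ⟨d, f, n, k, q, hd, rfl, hn1, hn2, hsb, hnk, hq⟩ := H.exists_split (by omega) hb hb0
  have hcd : c * d = (2 : ℝ) ^ (e + f) ∨ c * d = -(2 : ℝ) ^ (e + f) := by
    rw [zpow_add₀ two_ne_zero]
    rcases hc with rfl | rfl <;> rcases hd with rfl | rfl <;> simp
  have hc0 : c ≠ 0 := left_ne_zero_of_mul ha0
  have hd0 : d ≠ 0 := left_ne_zero_of_mul hb0
  have key := (H.conj hcd).dekker_int hp rfl hm1 hm2 hn1 hn2 hml hnk hl hq
  have hfl : ∀ x, fl x = c * d * (fl (c * d * (x / (c * d))) / (c * d)) := fun x => by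
    field_simp
  have hdiv : ∀ x y, fl (c * x * (d * y)) = c * d * (fl (c * d * (x * y)) / (c * d)) := fun x y => by
    rw [show c * x * (d * y) = c * d * (x * y) by ring]; field_simp
  have hsub : ∀ x y, fl (c * d * x - c * d * y) = c * d * (fl (c * d * (x - y)) / (c * d)) :=
    fun x y => by rw [mul_sub]; field_simp
  simp only [twoProd, hsa, hsb, hdiv, hsub]
  rw [key]
  ring

/-! ### Magnitude of the round-off errors -/

theorem unitRoundoff_nonneg (p : ℕ) : 0 ≤ unitRoundoff p := by unfold unitRoundoff; positivity

theorem unitRoundoff_le_one (p : ℕ) : unitRoundoff p ≤ 1 :=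
  pow_le_one₀ (by norm_num) (by norm_num)

theorem le_of_unitRoundoff_le {p k : ℕ} (h : unitRoundoff p ≤ (2 : ℝ)⁻¹ ^ k) : k ≤ p := by
  by_contra! hlt
  exact absurd h (not_le_of_gt (pow_lt_pow_right_of_lt_one₀ (by norm_num) (by norm_num) hlt))

theorem IsRoundToNearest.abs_fl_le {p : ℕ} {fl : ℝ → ℝ} (H : IsRoundToNearest p fl)
    (hp : 1 ≤ p) (x : ℝ) : |fl x| ≤ (1 + unitRoundoff p) * |x| := by
  have h1 := H.abs_sub_le_mul hp x
  have h2 := abs_sub_abs_le_abs_sub (fl x) x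
  rw [abs_sub_comm] at h2
  linarith

theorem IsRoundToNearest.isFloat_twoSum_fst {p : ℕ} {fl : ℝ → ℝ} (H : IsRoundToNearest p fl)
    (a b : ℝ) : IsFloat p (twoSum fl a b).1 := H.isFloat _

theorem IsRoundToNearest.isFloat_twoProd_fst {p : ℕ} {fl : ℝ → ℝ} (H : IsRoundToNearest p fl)
    (a b : ℝ) : IsFloat p (twoProd p fl a b).1 := H.isFloat _

theorem IsRoundToNearest.isFloat_twoSum_snd {p : ℕ} {fl : ℝ → ℝ} (H : IsRoundToNearest p fl)
    (a b : ℝ) : IsFloat p (twoSum fl a b).2 := H.isFloat _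

theorem IsRoundToNearest.abs_twoSum_snd_le {p : ℕ} {fl : ℝ → ℝ} (H : IsRoundToNearest p fl)
    (hp : 1 ≤ p) {a b : ℝ} (ha : IsFloat p a) (hb : IsFloat p b) :
    |(twoSum fl a b).2| ≤ unitRoundoff p * (|a| + |b|) := by
  rw [H.twoSum_snd hp ha hb]
  exact (H.abs_sub_le_mul hp (a + b)).trans
    (mul_le_mul_of_nonneg_left (abs_add_le a b) (unitRoundoff_nonneg p))

theorem IsRoundToNearest.abs_twoSum_fst_le {p : ℕ} {fl : ℝ → ℝ} (H : IsRoundToNearest p fl)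
    (hp : 1 ≤ p) (a b : ℝ) :
    |(twoSum fl a b).1| ≤ (1 + unitRoundoff p) * (|a| + |b|) :=
  (H.abs_fl_le hp (a + b)).trans
    (mul_le_mul_of_nonneg_left (abs_add_le a b) (by linarith [unitRoundoff_nonneg p]))

theorem IsRoundToNearest.abs_twoProd_snd_le {p : ℕ} {fl : ℝ → ℝ} (H : IsRoundToNearest p fl)
    (hp : 4 ≤ p) {a b : ℝ} (ha : IsFloat p a) (hb : IsFloat p b) :
    |(twoProd p fl a b).2| ≤ unitRoundoff p * |a * b| := by
  rw [H.twoProd_snd hp ha hb]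
  exact H.abs_sub_le_mul (by omega) (a * b)

theorem IsRoundToNearest.abs_twoProd_fst_le {p : ℕ} {fl : ℝ → ℝ} (H : IsRoundToNearest p fl)
    (hp : 1 ≤ p) (a b : ℝ) :
    |(twoProd p fl a b).1| ≤ (1 + unitRoundoff p) * |a * b| := H.abs_fl_le hp (a * b)

/-- The sum of the absolute values of the entries of a list. -/
def absSum (l : List ℝ) : ℝ := (l.map abs).sum

@[simp] theorem absSum_nil : absSum [] = 0 := rfl

@[simp] theorem absSum_cons (x : ℝ) (l : List ℝ) : absSum (x :: l) = |x| + absSum l := by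
  simp [absSum]

@[simp] theorem absSum_append (l l' : List ℝ) : absSum (l ++ l') = absSum l + absSum l' := by
  simp [absSum]

theorem absSum_nonneg (l : List ℝ) : 0 ≤ absSum l := by
  induction l with
  | nil => simp
  | cons x l ih => rw [absSum_cons]; positivity

theorem abs_sum_le_absSum (l : List ℝ) : |l.sum| ≤ absSum l := by
  induction l with
  | nil => simp
  | cons x l ih =>
    rw [absSum_cons, List.sum_cons]
    exact (abs_add_le _ _).trans (by linarith)

theorem length_sumEFT (fl : ℝ → ℝ) (l : List ℝ) (acc : ℝ) :
    (sumEFT fl acc l).1.length = l.length := by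
  induction l generalizing acc with
  | nil => rfl
  | cons x l ih => simp [sumEFT, ih]

theorem IsRoundToNearest.isFloat_sumEFT_fst {p : ℕ} {fl : ℝ → ℝ} (H : IsRoundToNearest p fl)
    (l : List ℝ) (acc : ℝ) : ∀ x ∈ (sumEFT fl acc l).1, IsFloat p x := by
  induction l generalizing acc with
  | nil => simp [sumEFT]
  | cons x l ih =>
    simp only [sumEFT, List.mem_cons, forall_eq_or_imp]
    exact ⟨H.isFloat_twoSum_snd _ _, ih _⟩

theorem IsRoundToNearest.isFloat_sumEFT_snd {p : ℕ} {fl : ℝ → ℝ} (H : IsRoundToNearest p fl)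
    (l : List ℝ) {acc : ℝ} (hacc : IsFloat p acc) : IsFloat p (sumEFT fl acc l).2 := by
  induction l generalizing acc with
  | nil => exact hacc
  | cons x l ih => exact ih (H.isFloat _)

theorem IsRoundToNearest.sumEFT_sum {p : ℕ} {fl : ℝ → ℝ} (H : IsRoundToNearest p fl)
    (hp : 1 ≤ p) {l : List ℝ} (hl : ∀ x ∈ l, IsFloat p x) {acc : ℝ} (hacc : IsFloat p acc) :
    (sumEFT fl acc l).1.sum = acc + l.sum - (sumEFT fl acc l).2 := by
  induction l generalizing acc with
  | nil => simp [sumEFT]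
  | cons x l ih =>
    simp only [List.mem_cons, forall_eq_or_imp] at hl
    simp only [sumEFT, List.sum_cons]
    rw [ih hl.2 (H.isFloat_twoSum_fst _ _), H.twoSum_snd hp hacc hl.1]
    ring

theorem IsRoundToNearest.absSum_sumEFT_le {p : ℕ} {fl : ℝ → ℝ} (H : IsRoundToNearest p fl)
    (hp : 1 ≤ p) {l : List ℝ} (hl : ∀ x ∈ l, IsFloat p x) {acc : ℝ} (hacc : IsFloat p acc) :
    absSum (sumEFT fl acc l).1 ≤ 3 ^ l.length * (unitRoundoff p * (|acc| + absSum l)) := by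
  have hu := unitRoundoff_nonneg p
  have hu1 := unitRoundoff_le_one p
  induction l generalizing acc with
  | nil => simpa [sumEFT] using mul_nonneg hu (abs_nonneg acc)
  | cons x l ih =>
    simp only [List.mem_cons, forall_eq_or_imp] at hl
    simp only [sumEFT, absSum_cons, List.length_cons]
    have h1 := ih hl.2 (H.isFloat_twoSum_fst acc x)
    have h2 := H.abs_twoSum_snd_le hp hacc hl.1
    have h3 := H.abs_twoSum_fst_le hp acc x
    have h4 := absSum_nonneg l
    have hx : 0 ≤ |acc| + |x| := by positivity
    set A := |acc| + |x| with hA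
    have h5 : |(twoSum fl acc x).1| ≤ 2 * A := h3.trans (by gcongr; linarith)
    have h6 : (1 : ℝ) ≤ 3 ^ l.length := one_le_pow₀ (by norm_num)
    have h7 : unitRoundoff p * (|(twoSum fl acc x).1| + absSum l) ≤
        unitRoundoff p * (2 * (A + absSum l)) := by gcongr; linarith
    have h8 : unitRoundoff p * A ≤ 3 ^ l.length * (unitRoundoff p * (A + absSum l)) := by
      have : unitRoundoff p * A ≤ unitRoundoff p * (A + absSum l) := by gcongr; linarith
      exact this.trans (le_mul_of_one_le_left (by positivity) h6)
    calc _ ≤ 3 ^ l.length * (unitRoundoff p * (A + absSum l))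
          + 3 ^ l.length * (unitRoundoff p * (2 * (A + absSum l))) := by
            refine add_le_add (h2.trans h8) (h1.trans ?_)
            gcongr 3 ^ l.length * ?_
      _ = _ := by rw [pow_succ, hA]; ring

theorem headD_add_sum_tail (e : List ℝ) : e.headD 0 + e.tail.sum = e.sum := by
  cases e <;> simp

theorem abs_headD_add_absSum_tail (e : List ℝ) : |e.headD 0| + absSum e.tail = absSum e := by
  cases e <;> simp

theorem isFloat_headD {p : ℕ} {e : List ℝ} (he : ∀ x ∈ e, IsFloat p x) :
    IsFloat p (e.headD 0) := by
  cases e with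
  | nil => exact isFloat_zero p
  | cons x l => exact he x (by simp)

/-- The properties of `LocalErrorEFT`. -/
theorem IsRoundToNearest.localErrorEFT_spec {p : ℕ} {fl : ℝ → ℝ} (H : IsRoundToNearest p fl)
    (hp : 4 ≤ p) {e : List ℝ} (he : ∀ x ∈ e, IsFloat p x) {L : ℕ} (hL : e.length ≤ L) {ρ δ : ℝ}
    (hρ : IsFloat p ρ) (hδ : IsFloat p δ) :
    (∀ x ∈ (localErrorEFT p fl e ρ δ).1, IsFloat p x) ∧
    IsFloat p (localErrorEFT p fl e ρ δ).2 ∧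
    (localErrorEFT p fl e ρ δ).1.length ≤ L - 1 + 2 ∧
    (localErrorEFT p fl e ρ δ).1.sum = e.sum + ρ * δ - (localErrorEFT p fl e ρ δ).2 ∧
    absSum (localErrorEFT p fl e ρ δ).1 ≤
      (2 * 3 ^ L + 3) * (unitRoundoff p * (absSum e + |ρ * δ|)) := by
  have hu := unitRoundoff_nonneg p
  have hu1 := unitRoundoff_le_one p
  have hh := isFloat_headD he
  have ht : ∀ x ∈ e.tail, IsFloat p x := fun x hx => he x (List.mem_of_mem_tail hx)
  have h1 := H.isFloat_sumEFT_fst e.tail (e.headD 0)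
  have h2 := H.isFloat_sumEFT_snd e.tail hh
  have h3 := H.sumEFT_sum (by omega) ht hh
  have h4 := H.absSum_sumEFT_le (by omega) ht hh
  have h5 := length_sumEFT fl e.tail (e.headD 0)
  rw [headD_add_sum_tail] at h3
  rw [abs_headD_add_absSum_tail] at h4
  simp only [localErrorEFT]
  set t := sumEFT fl (e.headD 0) e.tail
  have hPf : IsFloat p (twoProd p fl ρ δ).1 := H.isFloat _
  have hPf' : IsFloat p (twoProd p fl ρ δ).2 := H.isFloat _
  have hP := H.twoProd_snd hp hρ hδ
  have hPa := H.abs_twoProd_snd_le hp hρ hδ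
  have hPb := H.abs_twoProd_fst_le (by omega) ρ δ
  set P := twoProd p fl ρ δ
  have hS := H.twoSum_snd (by omega) h2 hPf
  have hSa := H.abs_twoSum_snd_le (by omega) h2 hPf
  refine ⟨?_, H.isFloat _, ?_, ?_, ?_⟩
  · intro x hx
    simp only [List.mem_append, List.mem_cons, List.not_mem_nil, or_false] at hx
    rcases hx with hx | rfl | rfl
    exacts [h1 x hx, hPf', H.isFloat_twoSum_snd _ _]
  · simp only [List.length_append, List.length_cons, List.length_nil, h5, List.length_tail]
    omega
  · simp only [List.sum_append, List.sum_cons, List.sum_nil, h3, hP, hS]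
    ring
  · simp only [absSum_append, absSum_cons, absSum_nil, add_zero]
    set T := absSum e with hT
    have hT0 : 0 ≤ T := absSum_nonneg e
    have hlen : (3 : ℝ) ^ e.tail.length ≤ 3 ^ L :=
      pow_le_pow_right₀ (by norm_num) (by rw [List.length_tail]; omega)
    have h4' : absSum t.1 ≤ 3 ^ L * (unitRoundoff p * T) := h4.trans (by gcongr)
    have ht2 : |t.2| ≤ T + 3 ^ L * T := by
      have e1 : t.2 = e.sum - t.1.sum := by rw [h3]; ring
      rw [e1]
      refine (abs_sub _ _).trans (add_le_add (abs_sum_le_absSum e) ?_)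
      refine (abs_sum_le_absSum _).trans (h4'.trans ?_)
      refine mul_le_mul_of_nonneg_left ?_ (by positivity)
      exact mul_le_of_le_one_left hT0 hu1
    have hPb' : |P.1| ≤ 2 * |ρ * δ| := hPb.trans (by gcongr; linarith)
    have h6 : unitRoundoff p * (|t.2| + |P.1|) ≤
        unitRoundoff p * (T + 3 ^ L * T + 2 * |ρ * δ|) := by gcongr
    have h7 : 0 ≤ 3 ^ L * (unitRoundoff p * |ρ * δ|) := by positivity
    have h8 : 0 ≤ unitRoundoff p * T := by positivity
    linarith

/-! ### The local errors -/

/-- The exact value of the local error at level `F`, i.e. the sum of the round-off errors at level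
`F - 1` and of the contribution of the representation error of `1 - s`. -/
def localSum (p : ℕ) (fl : ℝ → ℝ) (s : ℝ) (v : ℕ → ℕ → ℝ) (j : ℕ) : ℕ → ℝ
  | 0 => 0
  | F + 1 => (stage p fl s v j F).2.sum + (twoSum fl 1 (-s)).2 * v F j

/-- The sum of the absolute values of the terms of `localSum`. -/
def localAbsSum (p : ℕ) (fl : ℝ → ℝ) (s : ℝ) (v : ℕ → ℕ → ℝ) (j : ℕ) : ℕ → ℝ
  | 0 => 0
  | F + 1 => absSum (stage p fl s v j F).2 + |(twoSum fl 1 (-s)).2 * v F j|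

theorem localAbsSum_nonneg (p : ℕ) (fl : ℝ → ℝ) (s : ℝ) (v : ℕ → ℕ → ℝ) (j F : ℕ) :
    0 ≤ localAbsSum p fl s v j F := by
  cases F with
  | zero => exact le_rfl
  | succ F => exact add_nonneg (absSum_nonneg _) (abs_nonneg _)

theorem abs_localSum_le (p : ℕ) (fl : ℝ → ℝ) (s : ℝ) (v : ℕ → ℕ → ℝ) (j F : ℕ) :
    |localSum p fl s v j F| ≤ localAbsSum p fl s v j F := by
  cases F with
  | zero => simp [localSum, localAbsSum]
  | succ F => exact (abs_add_le _ _).trans (by simpa [localAbsSum] using abs_sum_le_absSum _)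

/-- A constant for the higher order contributions to the local errors. -/
def localConst (F : ℕ) : ℝ := 5 * (2 * 3 ^ (5 * F + 3) + 3) + 4

theorem localConst_nonneg (F : ℕ) : 0 ≤ localConst F := by unfold localConst; positivity

theorem IsRoundToNearest.isFloat_stage {p : ℕ} {fl : ℝ → ℝ} (H : IsRoundToNearest p fl)
    (s : ℝ) (v : ℕ → ℕ → ℝ) (j F : ℕ) : IsFloat p (stage p fl s v j F).1 := by
  cases F <;> exact H.isFloat _

theorem IsRoundToNearest.stage_errors {p : ℕ} {fl : ℝ → ℝ} (H : IsRoundToNearest p fl)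
    (hp : 4 ≤ p) (s : ℝ) {v : ℕ → ℕ → ℝ} {j : ℕ}
    (hv : ∀ F, IsFloat p (v F j)) (F : ℕ) :
    (∀ x ∈ (stage p fl s v j F).2, IsFloat p x) ∧
      (stage p fl s v j F).2.length ≤ 5 * F + 3 := by
  have hρ : IsFloat p (twoSum fl 1 (-s)).2 := H.isFloat _
  induction F with
  | zero =>
    constructor
    · intro x hx
      simp only [stage, List.mem_cons, List.not_mem_nil, or_false] at hx
      rcases hx with rfl | rfl | rfl <;> exact H.isFloat _
    · simp [stage]
  | succ F ih =>
    obtain ⟨h1, h2, h3, -, -⟩ := H.localErrorEFT_spec hp ih.1 ih.2 hρ (hv F)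
    constructor
    · intro x hx
      simp only [stage, List.mem_append, List.mem_cons, List.not_mem_nil, or_false] at hx
      rcases hx with hx | rfl | rfl | rfl | rfl
      · exact h1 x hx
      all_goals exact H.isFloat _
    · simp only [stage, List.length_append, List.length_cons, List.length_nil]
      omega

theorem IsRoundToNearest.stage_fst {p : ℕ} {fl : ℝ → ℝ} (H : IsRoundToNearest p fl)
    (hp : 4 ≤ p) {s : ℝ} (hs : IsFloat p s) {v : ℕ → ℕ → ℝ} {j : ℕ}
    (hv : ∀ F, IsFloat p (v F j)) (hv' : ∀ F, IsFloat p (v F (j + 1))) (F : ℕ) :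
    (stage p fl s v j F).1 = localSum p fl s v j F + (1 - s) * v F j + s * v F (j + 1)
      - localSum p fl s v j (F + 1) := by
  have hp1 : 1 ≤ p := by omega
  have hr : IsFloat p (twoSum fl 1 (-s)).1 := H.isFloat _
  have hρ : IsFloat p (twoSum fl 1 (-s)).2 := H.isFloat _
  have hρ' := H.twoSum_snd hp1 (isFloat_one hp1) hs.neg
  cases F with
  | zero =>
    simp only [stage, localSum, List.sum_cons, List.sum_nil]
    rw [H.twoSum_snd hp1 (H.isFloat_twoProd_fst _ _) (H.isFloat_twoProd_fst _ _),
      H.twoProd_snd hp hr (hv 0), H.twoProd_snd hp hs (hv' 0), hρ']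
    ring
  | succ F =>
    obtain ⟨he, hlen⟩ := H.stage_errors hp s hv F
    obtain ⟨-, h2, -, h4, -⟩ := H.localErrorEFT_spec hp he hlen hρ (hv F)
    rw [localSum, localSum]
    rw [stage]
    simp only [List.sum_append, List.sum_cons, List.sum_nil, h4]
    rw [H.twoSum_snd hp1 (H.isFloat_twoSum_fst _ _) (H.isFloat_twoProd_fst _ _),
      H.twoSum_snd hp1 h2 (H.isFloat_twoProd_fst _ _),
      H.twoProd_snd hp hr (hv _), H.twoProd_snd hp hs (hv' _)]
    simp only [hρ']
    ring

set_option maxHeartbeats 1000000 in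
theorem IsRoundToNearest.localAbsSum_succ_le {p : ℕ} {fl : ℝ → ℝ} (H : IsRoundToNearest p fl)
    (hp : 4 ≤ p) {s : ℝ} (hs : IsFloat p s) (hs0 : 0 ≤ s) (hs1 : s ≤ 1) {v : ℕ → ℕ → ℝ} {j : ℕ}
    (hv : ∀ F, IsFloat p (v F j)) (hv' : ∀ F, IsFloat p (v F (j + 1))) (F : ℕ) :
    localAbsSum p fl s v j (F + 1) ≤
      localConst F * (unitRoundoff p * localAbsSum p fl s v j F) +
      3 * unitRoundoff p * (1 + unitRoundoff p) ^ 3 *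
        ((1 - s) * |v F j| + s * |v F (j + 1)|) := by
  have hp1 : 1 ≤ p := by omega
  have hu := unitRoundoff_nonneg p
  have hu1 := unitRoundoff_le_one p
  have hr : IsFloat p (twoSum fl 1 (-s)).1 := H.isFloat _
  have hρ : IsFloat p (twoSum fl 1 (-s)).2 := H.isFloat _
  have hra : |(twoSum fl 1 (-s)).1| ≤ (1 + unitRoundoff p) * (1 - s) := by
    have := H.abs_fl_le hp1 (1 + -s)
    rwa [← sub_eq_add_neg, abs_of_nonneg (sub_nonneg.2 hs1)] at this
  have hρa : |(twoSum fl 1 (-s)).2| ≤ unitRoundoff p * (1 - s) := by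
    rw [H.twoSum_snd hp1 (isFloat_one hp1) hs.neg]
    have := H.abs_sub_le_mul hp1 (1 + -s)
    rwa [← sub_eq_add_neg, abs_of_nonneg (sub_nonneg.2 hs1)] at this
  rw [localAbsSum]
  set u := unitRoundoff p with hudef
  have hx₁ : |s * v F (j + 1)| = s * |v F (j + 1)| := by rw [abs_mul, abs_of_nonneg hs0]
  have hx₀ : |(twoSum fl 1 (-s)).1 * v F j| ≤ (1 + u) * ((1 - s) * |v F j|) := by
    rw [abs_mul, ← mul_assoc]; gcongr
  have hxρ : |(twoSum fl 1 (-s)).2 * v F j| ≤ u * ((1 - s) * |v F j|) := by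
    rw [abs_mul, ← mul_assoc]; gcongr
  have a1 := H.abs_twoProd_snd_le hp hs (hv' F)
  have a2 := H.abs_twoProd_fst_le hp1 s (v F (j + 1))
  have a3 := H.abs_twoProd_snd_le hp hr (hv F)
  have a4 := H.abs_twoProd_fst_le hp1 (twoSum fl 1 (-s)).1 (v F j)
  rw [hx₁] at a1 a2
  set Y := s * |v F (j + 1)| with hY
  set Z := (1 - s) * |v F j| with hZ
  have hY0 : 0 ≤ Y := by positivity
  have hZ0 : 0 ≤ Z := mul_nonneg (sub_nonneg.2 hs1) (abs_nonneg _)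
  have a3' : |(twoProd p fl (twoSum fl 1 (-s)).1 (v F j)).2| ≤ u * ((1 + u) * Z) :=
    a3.trans (by gcongr)
  have a4' : |(twoProd p fl (twoSum fl 1 (-s)).1 (v F j)).1| ≤ (1 + u) * ((1 + u) * Z) :=
    a4.trans (by gcongr)
  have hf1 : IsFloat p (twoProd p fl s (v F (j + 1))).1 := H.isFloat _
  have hf2 : IsFloat p (twoProd p fl (twoSum fl 1 (-s)).1 (v F j)).1 := H.isFloat _
  cases F with
  | zero =>
    rw [localAbsSum]
    simp only [stage, absSum_cons, absSum_nil]
    set P₁ := twoProd p fl (twoSum fl 1 (-s)).1 (v 0 j)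
    set P₂ := twoProd p fl s (v 0 (j + 1))
    have b := H.abs_twoSum_snd_le hp1 hf2 hf1
    have b' : |(twoSum fl P₁.1 P₂.1).2| ≤ u * ((1 + u) * ((1 + u) * Z) + (1 + u) * Y) :=
      b.trans (by gcongr)
    have k1 : 0 ≤ u * Z := by positivity
    have k2 : 0 ≤ u * Y := by positivity
    have k3 : 0 ≤ u * (u * Z) := by positivity
    have k4 : 0 ≤ u * (u * Y) := by positivity
    have k5 : 0 ≤ u * (u * (u * Z)) := by positivity
    have k6 : 0 ≤ u * (u * (u * Y)) := by positivity
    have k7 : 0 ≤ u * (u * (u * (u * Z))) := by positivity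
    have k8 : 0 ≤ u * (u * (u * (u * Y))) := by positivity
    linarith
  | succ F =>
    obtain ⟨he, hlen⟩ := H.stage_errors hp s hv F
    obtain ⟨-, h2, -, h4, h5⟩ := H.localErrorEFT_spec hp he hlen hρ (hv F)
    rw [show localAbsSum p fl s v j (F + 1) = absSum (stage p fl s v j F).2 +
      |(twoSum fl 1 (-s)).2 * v F j| from rfl]
    set G := absSum (stage p fl s v j F).2 + |(twoSum fl 1 (-s)).2 * v F j| with hG
    have hG0 : 0 ≤ G := add_nonneg (absSum_nonneg _) (abs_nonneg _)
    rw [stage]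
    simp only [absSum_append, absSum_cons, absSum_nil]
    have hl2 : |(localErrorEFT p fl (stage p fl s v j F).2 (twoSum fl 1 (-s)).2 (v F j)).2| ≤
        (1 + (2 * 3 ^ (5 * F + 3) + 3)) * G := by
      have e1 := h4
      rw [eq_sub_iff_add_eq, ← eq_sub_iff_add_eq'] at e1
      rw [e1]
      have h6 := abs_sum_le_absSum (localErrorEFT p fl (stage p fl s v j F).2
        (twoSum fl 1 (-s)).2 (v F j)).1
      have h7 : |(stage p fl s v j F).2.sum + (twoSum fl 1 (-s)).2 * v F j| ≤ G :=
        (abs_add_le _ _).trans (by rw [hG]; gcongr; exact abs_sum_le_absSum _)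
      have h8 : u * G ≤ G := mul_le_of_le_one_left hG0 hu1
      have h9 : (2 * 3 ^ (5 * F + 3) + 3) * (u * G) ≤ (2 * 3 ^ (5 * F + 3) + 3) * G := by gcongr
      refine (abs_sub _ _).trans ?_
      linarith
    set c : ℝ := 2 * 3 ^ (5 * F + 3) + 3 with hc
    have hc0 : 0 ≤ c := by positivity
    have hcc : 5 * c + 4 ≤ localConst (F + 1) := by
      rw [localConst, hc]
      have : (3 : ℝ) ^ (5 * F + 3) ≤ 3 ^ (5 * (F + 1) + 3) :=
        pow_le_pow_right₀ (by norm_num) (by omega)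
      linarith
    set l := localErrorEFT p fl (stage p fl s v j F).2 (twoSum fl 1 (-s)).2 (v F j)
    set P₁ := twoProd p fl s (v (F + 1) (j + 1))
    set P₃ := twoProd p fl (twoSum fl 1 (-s)).1 (v (F + 1) j)
    have b1 := H.abs_twoSum_snd_le hp1 h2 hf1
    have b2 := H.abs_twoSum_fst_le hp1 l.2 P₁.1
    have b1' : |(twoSum fl l.2 P₁.1).2| ≤ u * ((1 + c) * G + (1 + u) * Y) :=
      b1.trans (by gcongr)
    have b2' : |(twoSum fl l.2 P₁.1).1| ≤ (1 + u) * ((1 + c) * G + (1 + u) * Y) :=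
      b2.trans (by gcongr)
    have hf3 : IsFloat p (twoSum fl l.2 P₁.1).1 := H.isFloat _
    have b3 := H.abs_twoSum_snd_le hp1 hf3 hf2
    have b3' : |(twoSum fl (twoSum fl l.2 P₁.1).1 P₃.1).2| ≤
        u * ((1 + u) * ((1 + c) * G + (1 + u) * Y) + (1 + u) * ((1 + u) * Z)) :=
      b3.trans (by gcongr)
    have k0 : u * ((1 + u) * ((1 + c) * G)) ≤ u * (2 * ((1 + c) * G)) := by gcongr; linarith
    have k9 : (5 * c + 4) * (u * G) ≤ localConst (F + 1) * (u * G) := by gcongr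
    have k10 : 0 ≤ c * (u * G) := by positivity
    have k11 : 0 ≤ u * G := by positivity
    have k1 : 0 ≤ u * Z := by positivity
    have k2 : 0 ≤ u * Y := by positivity
    have k3 : 0 ≤ u * (u * Z) := by positivity
    have k4 : 0 ≤ u * (u * Y) := by positivity
    have k5 : 0 ≤ u * (u * (u * Z)) := by positivity
    have k6 : 0 ≤ u * (u * (u * Y)) := by positivity
    have k7 : 0 ≤ u * (u * (u * (u * Z))) := by positivity
    have k8 : 0 ≤ u * (u * (u * (u * Y))) := by positivity
    have main : c * (u * G) + (u * Y + u * ((1 + c) * G + (1 + u) * Y) + u * ((1 + u) * Z) +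
        u * ((1 + u) * ((1 + c) * G) + ((1 + u) * ((1 + u) * Y) + (1 + u) * ((1 + u) * Z))))
        + u * Z ≤
        (5 * c + 4) * (u * G) + 3 * u * (1 + u) ^ 3 * (Z + Y) := by
      linarith
    linarith

open Polynomial

/-! ### The absolute Bernstein sum -/

theorem exactTable_eq_sum (b : ℕ → ℝ) (s : ℝ) (i j : ℕ) :
    exactTable b s i j =
      ∑ l ∈ Finset.range (i + 1), b (j + l) * ((i.choose l : ℝ) * s ^ l * (1 - s) ^ (i - l)) := by
  induction i generalizing j with
  | zero => simp [exactTable]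
  | succ i ih =>
    have h0 : ∑ l ∈ Finset.range (i + 1),
        b (j + l) * ((i.choose l : ℝ) * s ^ l * (1 - s) ^ (i + 1 - l)) =
        ∑ l ∈ Finset.range (i + 2),
          b (j + l) * ((i.choose l : ℝ) * s ^ l * (1 - s) ^ (i + 1 - l)) := by
      rw [Finset.sum_range_succ _ (i + 1)]; simp
    have h1 : (1 - s) * exactTable b s i j = ∑ l ∈ Finset.range (i + 1),
        b (j + l) * ((i.choose l : ℝ) * s ^ l * (1 - s) ^ (i + 1 - l)) := by
      rw [ih, Finset.mul_sum]
      refine Finset.sum_congr rfl fun l hl => ?_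
      have : l ≤ i := Nat.lt_succ_iff.1 (Finset.mem_range.1 hl)
      rw [Nat.sub_add_comm this, pow_succ]; ring
    change (1 - s) * exactTable b s i j + s * exactTable b s i (j + 1) = _
    rw [h1, h0, ih, Finset.sum_range_succ', Finset.sum_range_succ' _ (i + 1),
      Finset.mul_sum, add_right_comm, ← Finset.sum_add_distrib]
    congr 1
    · refine Finset.sum_congr rfl fun l _ => ?_
      rw [Nat.choose_succ_succ, Nat.add_sub_add_right, show j + 1 + l = j + (l + 1) by ring]
      push_cast; ring
    · simp

theorem exactTable_abs_eq_absBernsteinSum (b : ℕ → ℝ) (s : ℝ) (n : ℕ) :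
    exactTable (fun l => |b l|) s n 0 = absBernsteinSum n b s := by
  simp [exactTable_eq_sum, absBernsteinSum, bernsteinPolynomial]

/-! ### The majorants -/

/-- The majorants of the local absolute sums of the next step, obtained from the majorants `x F`
of the computed values at all levels `F`. -/
noncomputable def localMajorant (c : ℕ → ℝ) (x : ℕ → ℝ[X]) : ℕ → ℝ[X]
  | 0 => 0
  | F + 1 => C (c F) * localMajorant c x F + 3 * (1 + X) ^ 3 * x F

/-- The majorants of the computed values after `i` steps at level `F`. -/
noncomputable def valueMajorant (c : ℕ → ℝ) : ℕ → ℕ → ℝ[X]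
  | 0 => fun F => if F = 0 then 1 else 0
  | i + 1 => fun F => (1 + C (c F + 24) * X) *
      (localMajorant c (valueMajorant c i) F + valueMajorant c i F)

/-- The majorants of the global errors after `i` steps at level `F`. -/
noncomputable def errorMajorant (c : ℕ → ℝ) : ℕ → ℕ → ℝ[X]
  | 0 => fun _ => 0
  | i + 1 => fun F => localMajorant c (valueMajorant c i) F + errorMajorant c i F

theorem eval_valueMajorant_succ (c : ℕ → ℝ) (i F : ℕ) :
    (valueMajorant c (i + 1) F).eval 0 =
      (localMajorant c (valueMajorant c i) F).eval 0 + (valueMajorant c i F).eval 0 := by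
  simp [valueMajorant]

theorem eval_localMajorant_succ (c : ℕ → ℝ) (x : ℕ → ℝ[X]) (F : ℕ) :
    (localMajorant c x (F + 1)).eval 0 =
      c F * (localMajorant c x F).eval 0 + 3 * (x F).eval 0 := by
  simp [localMajorant]

theorem eval_valueMajorant_zero (c : ℕ → ℝ) (i : ℕ) : (valueMajorant c i 0).eval 0 = 1 := by
  induction i with
  | zero => simp [valueMajorant]
  | succ i ih => rw [eval_valueMajorant_succ, ih]; simp [localMajorant]

theorem eval_errorMajorant (c : ℕ → ℝ) (i F : ℕ) :
    (errorMajorant c i (F + 1)).eval 0 = (valueMajorant c i (F + 1)).eval 0 := by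
  induction i with
  | zero => simp [errorMajorant, valueMajorant]
  | succ i ih => rw [eval_valueMajorant_succ, ← ih]; simp [errorMajorant]

theorem exists_majorant_le {c : ℕ → ℝ} (hc : ∀ F, 0 ≤ c F) (F : ℕ) :
    ∃ a : ℝ, 0 ≤ a ∧ ∀ i : ℕ,
      (localMajorant c (valueMajorant c i) (F + 1)).eval 0 ≤
        3 ^ (F + 1) * (i.choose F : ℝ) + a * ((i : ℝ) + 1) ^ (F - 1) ∧
      (valueMajorant c i (F + 1)).eval 0 ≤
        3 ^ (F + 1) * (i.choose (F + 1) : ℝ) + a * (i : ℝ) ^ F := by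
  induction F with
  | zero =>
    refine ⟨0, le_rfl, fun i => ?_⟩
    have h : ∀ i, (localMajorant c (valueMajorant c i) (0 + 1)).eval 0 = 3 := fun i => by
      rw [eval_localMajorant_succ, eval_valueMajorant_zero]; simp [localMajorant]
    refine ⟨by rw [h]; simp, ?_⟩
    induction i with
    | zero => simp [valueMajorant]
    | succ i ih =>
      rw [eval_valueMajorant_succ, h]
      simp at ih ⊢
      linarith
  | succ F ih =>
    obtain ⟨a, ha, h⟩ := ih
    have hcF := hc (F + 1)
    set a' := c (F + 1) * 3 ^ (F + 1) + c (F + 1) * a + 3 * a with ha'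
    have ha0 : 0 ≤ a' := by positivity
    have h1 : ∀ i : ℕ, (localMajorant c (valueMajorant c i) (F + 2)).eval 0 ≤
        3 ^ (F + 2) * (i.choose (F + 1) : ℝ) + a' * ((i : ℝ) + 1) ^ F := by
      intro i
      rw [eval_localMajorant_succ]
      have e1 : (i.choose F : ℝ) ≤ ((i : ℝ) + 1) ^ F :=
        (by exact_mod_cast Nat.choose_le_pow i F : (i.choose F : ℝ) ≤ (i : ℝ) ^ F).trans
          (by gcongr; linarith)
      have e2 : ((i : ℝ) + 1) ^ (F - 1) ≤ ((i : ℝ) + 1) ^ F :=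
        pow_le_pow_right₀ (by linarith [Nat.cast_nonneg (α := ℝ) i]) (by omega)
      have e3 : (i : ℝ) ^ F ≤ ((i : ℝ) + 1) ^ F := by gcongr; linarith
      calc _ ≤ c (F + 1) * (3 ^ (F + 1) * ((i : ℝ) + 1) ^ F + a * ((i : ℝ) + 1) ^ F) +
            3 * (3 ^ (F + 1) * (i.choose (F + 1) : ℝ) + a * ((i : ℝ) + 1) ^ F) := by
            refine add_le_add (mul_le_mul_of_nonneg_left ((h i).1.trans ?_) hcF)
              (mul_le_mul_of_nonneg_left ((h i).2.trans ?_) (by norm_num))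
            · gcongr
            · gcongr
        _ = _ := by rw [ha']; ring
    refine ⟨a', ha0, fun i => ⟨h1 i, ?_⟩⟩
    induction i with
    | zero => simp [valueMajorant]
    | succ i ihi =>
      rw [eval_valueMajorant_succ]
      have e3 : (i : ℝ) ^ F ≤ ((i : ℝ) + 1) ^ F := by gcongr; linarith
      have e4 : a' * (i : ℝ) ^ (F + 1) ≤ a' * (((i : ℝ) + 1) ^ F * i) := by
        rw [pow_succ]; gcongr
      have e5 := h1 i
      rw [Nat.choose_succ_succ i (F + 1)]
      push_cast
      rw [pow_succ ((i : ℝ) + 1) F]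
      simp only [Nat.add_assoc, Nat.reduceAdd] at ihi e4 ⊢
      linarith

theorem exists_eval_le (f : ℝ[X]) :
    ∃ D : ℝ, ∀ u : ℝ, 0 ≤ u → u ≤ 1 → f.eval u ≤ f.eval 0 + D * u := by
  obtain ⟨D, hD⟩ := (isCompact_Icc (a := (0 : ℝ)) (b := 1)).bddAbove_image
    (f.divX.continuous.continuousOn)
  refine ⟨D, fun u h0 h1 => ?_⟩
  have h := congrArg (eval u) f.divX_mul_X_add
  rw [eval_add, eval_mul, eval_X, eval_C, coeff_zero_eq_eval_zero] at h
  have := hD ⟨u, ⟨h0, h1⟩, rfl⟩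
  nlinarith

/-! ### The global errors -/

/-- The global error of order `F` after `i` steps, i.e. with superscript `n - i`. -/
def errorTable (p : ℕ) (fl : ℝ → ℝ) (b : ℕ → ℝ) (s : ℝ) : ℕ → ℕ → ℕ → ℝ
  | 0, i, j => exactTable b s i j
  | F + 1, i, j => errorTable p fl b s F i j - table p fl b s i F j

theorem globalError_eq_errorTable (p : ℕ) (fl : ℝ → ℝ) (n : ℕ) (b : ℕ → ℝ) (s : ℝ) (F k j : ℕ) :
    globalError p fl n b s F k j = errorTable p fl b s F (n - k) j := by
  induction F with
  | zero => rfl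
  | succ F ih => rw [globalError, ih, errorTable, computed]

theorem errorTable_succ_zero (p : ℕ) (fl : ℝ → ℝ) (b : ℕ → ℝ) (s : ℝ) (F j : ℕ) :
    errorTable p fl b s (F + 1) 0 j = 0 := by
  induction F with
  | zero => simp [errorTable, exactTable, table]
  | succ F ih => rw [errorTable, ih]; simp [table]

theorem IsRoundToNearest.isFloat_table {p : ℕ} {fl : ℝ → ℝ} (H : IsRoundToNearest p fl)
    {b : ℕ → ℝ} (s : ℝ) {i j : ℕ} (hb : ∀ l ≤ i, IsFloat p (b (j + l))) (F : ℕ) :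
    IsFloat p (table p fl b s i F j) := by
  cases i with
  | zero =>
    simp only [table]
    split_ifs
    · exact hb 0 le_rfl
    · exact isFloat_zero p
  | succ i => exact H.isFloat_stage _ _ _ _

theorem IsRoundToNearest.errorTable_succ {p : ℕ} {fl : ℝ → ℝ} (H : IsRoundToNearest p fl)
    (hp : 4 ≤ p) {b : ℕ → ℝ} {s : ℝ} (hs : IsFloat p s) {i j : ℕ}
    (hv : ∀ F, IsFloat p (table p fl b s i F j))
    (hv' : ∀ F, IsFloat p (table p fl b s i F (j + 1))) (F : ℕ) :
    errorTable p fl b s F (i + 1) j = localSum p fl s (table p fl b s i) j F +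
      (1 - s) * errorTable p fl b s F i j + s * errorTable p fl b s F i (j + 1) := by
  induction F with
  | zero => rw [localSum, zero_add]; rfl
  | succ F ih =>
    have h : table p fl b s (i + 1) F j = (stage p fl s (table p fl b s i) j F).1 := rfl
    rw [errorTable, ih, h, H.stage_fst hp hs hv hv' F, errorTable, errorTable]
    ring

theorem IsRoundToNearest.localAbsSum_le {p : ℕ} {fl : ℝ → ℝ} (H : IsRoundToNearest p fl)
    (hp : 4 ≤ p) {s : ℝ} (hs : IsFloat p s) (hs0 : 0 ≤ s) (hs1 : s ≤ 1) {v : ℕ → ℕ → ℝ} {j : ℕ}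
    (hv : ∀ F, IsFloat p (v F j)) (hv' : ∀ F, IsFloat p (v F (j + 1))) {x : ℕ → ℝ[X]} {B : ℝ}
    (hx : ∀ F, (1 - s) * |v F j| + s * |v F (j + 1)| ≤
      unitRoundoff p ^ F * (x F).eval (unitRoundoff p) * B) (F : ℕ) :
    localAbsSum p fl s v j F ≤
      unitRoundoff p ^ F * (localMajorant localConst x F).eval (unitRoundoff p) * B := by
  have hu := unitRoundoff_nonneg p
  induction F with
  | zero => simp [localAbsSum, localMajorant]
  | succ F ih =>
    refine (H.localAbsSum_succ_le hp hs hs0 hs1 hv hv' F).trans ?_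
    have hc := localConst_nonneg F
    have h1 := mul_le_mul_of_nonneg_left (mul_le_mul_of_nonneg_left ih hu) hc
    have h2 := mul_le_mul_of_nonneg_left (hx F)
      (show 0 ≤ 3 * unitRoundoff p * (1 + unitRoundoff p) ^ 3 by positivity)
    refine (add_le_add h1 h2).trans (le_of_eq ?_)
    simp only [localMajorant, eval_add, eval_mul, eval_pow, eval_C, eval_X, eval_one, eval_ofNat]
    ring

theorem IsRoundToNearest.abs_stage_fst_le {p : ℕ} {fl : ℝ → ℝ} (H : IsRoundToNearest p fl)
    (hp : 4 ≤ p) {s : ℝ} (hs : IsFloat p s) (hs0 : 0 ≤ s) (hs1 : s ≤ 1) {v : ℕ → ℕ → ℝ} {j : ℕ}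
    (hv : ∀ F, IsFloat p (v F j)) (hv' : ∀ F, IsFloat p (v F (j + 1))) (F : ℕ) :
    |(stage p fl s v j F).1| ≤ (1 + (localConst F + 24) * unitRoundoff p) *
      (localAbsSum p fl s v j F + ((1 - s) * |v F j| + s * |v F (j + 1)|)) := by
  have hu := unitRoundoff_nonneg p
  have hu1 := unitRoundoff_le_one p
  have h1 := H.localAbsSum_succ_le hp hs hs0 hs1 hv hv' F
  have h2 := abs_localSum_le p fl s v j F
  have h3 := abs_localSum_le p fl s v j (F + 1)
  have hG := localAbsSum_nonneg p fl s v j F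
  have hc := localConst_nonneg F
  have hs1' : 0 ≤ 1 - s := sub_nonneg.2 hs1
  have hW : 0 ≤ (1 - s) * |v F j| + s * |v F (j + 1)| := by positivity
  have h4 : |(1 - s) * v F j + s * v F (j + 1)| ≤ (1 - s) * |v F j| + s * |v F (j + 1)| := by
    refine (abs_add_le _ _).trans (le_of_eq ?_)
    rw [abs_mul, abs_mul, abs_of_nonneg hs0, abs_of_nonneg hs1']
  rw [H.stage_fst hp hs hv hv' F, add_assoc]
  set W := (1 - s) * |v F j| + s * |v F (j + 1)|
  set G := localAbsSum p fl s v j F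
  set u := unitRoundoff p
  have h5 : (1 + u) ^ 3 ≤ 8 :=
    (pow_le_pow_left₀ (by positivity) (show 1 + u ≤ 2 by linarith) 3).trans (by norm_num)
  have h6 : 3 * u * (1 + u) ^ 3 * W ≤ 3 * u * 8 * W := by gcongr
  have h7 : 0 ≤ localConst F * u * W := by positivity
  have h8 : 0 ≤ u * G := by positivity
  refine (abs_sub _ _).trans ((add_le_add (abs_add_le _ _) le_rfl).trans ?_)
  linarith

theorem IsRoundToNearest.abs_table_le {p : ℕ} {fl : ℝ → ℝ} (H : IsRoundToNearest p fl)
    (hp : 4 ≤ p) {b : ℕ → ℝ} {s : ℝ} (hs : IsFloat p s) (hs0 : 0 ≤ s) (hs1 : s ≤ 1) (i : ℕ) {j : ℕ}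
    (hb : ∀ l ≤ i, IsFloat p (b (j + l))) (F : ℕ) :
    |table p fl b s i F j| ≤ unitRoundoff p ^ F *
      (valueMajorant localConst i F).eval (unitRoundoff p) *
        exactTable (fun l => |b l|) s i j := by
  have hu := unitRoundoff_nonneg p
  have hs1' : 0 ≤ 1 - s := sub_nonneg.2 hs1
  induction i generalizing j F with
  | zero => rcases F with _ | F <;> simp [table, valueMajorant, exactTable]
  | succ i ih =>
    have hb0 : ∀ l ≤ i, IsFloat p (b (j + l)) := fun l hl => hb l (by omega)
    have hb1 : ∀ l ≤ i, IsFloat p (b (j + 1 + l)) := fun l hl => by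
      rw [add_assoc, add_comm 1]; exact hb (l + 1) (by omega)
    have hv := H.isFloat_table s hb0
    have hv' := H.isFloat_table s hb1
    have hx : ∀ F, (1 - s) * |table p fl b s i F j| + s * |table p fl b s i F (j + 1)| ≤
        unitRoundoff p ^ F * (valueMajorant localConst i F).eval (unitRoundoff p) *
          exactTable (fun l => |b l|) s (i + 1) j := fun F => by
      have h0 := mul_le_mul_of_nonneg_left (ih hb0 F) hs1'
      have h1 := mul_le_mul_of_nonneg_left (ih hb1 F) hs0
      refine (add_le_add h0 h1).trans (le_of_eq ?_)
      simp only [exactTable]; ring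
    have hG := H.localAbsSum_le hp hs hs0 hs1 hv hv' hx F
    have hc := localConst_nonneg F
    refine (H.abs_stage_fst_le hp hs hs0 hs1 hv hv' F).trans ?_
    refine (mul_le_mul_of_nonneg_left (add_le_add hG (hx F)) (by positivity)).trans (le_of_eq ?_)
    simp only [valueMajorant, eval_add, eval_mul, eval_C, eval_X, eval_one]
    ring

theorem IsRoundToNearest.abs_errorTable_le {p : ℕ} {fl : ℝ → ℝ} (H : IsRoundToNearest p fl)
    (hp : 4 ≤ p) {b : ℕ → ℝ} {s : ℝ} (hs : IsFloat p s) (hs0 : 0 ≤ s) (hs1 : s ≤ 1) (i : ℕ) {j : ℕ}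
    (hb : ∀ l ≤ i, IsFloat p (b (j + l))) (F : ℕ) :
    |errorTable p fl b s (F + 1) i j| ≤ unitRoundoff p ^ (F + 1) *
      (errorMajorant localConst i (F + 1)).eval (unitRoundoff p) *
        exactTable (fun l => |b l|) s i j := by
  have hs1' : 0 ≤ 1 - s := sub_nonneg.2 hs1
  induction i generalizing j with
  | zero => simp [errorTable_succ_zero, errorMajorant]
  | succ i ih =>
    have hb0 : ∀ l ≤ i, IsFloat p (b (j + l)) := fun l hl => hb l (by omega)
    have hb1 : ∀ l ≤ i, IsFloat p (b (j + 1 + l)) := fun l hl => by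
      rw [add_assoc, add_comm 1]; exact hb (l + 1) (by omega)
    have hv := H.isFloat_table s hb0
    have hv' := H.isFloat_table s hb1
    have hx : ∀ F, (1 - s) * |table p fl b s i F j| + s * |table p fl b s i F (j + 1)| ≤
        unitRoundoff p ^ F * (valueMajorant localConst i F).eval (unitRoundoff p) *
          exactTable (fun l => |b l|) s (i + 1) j := fun F => by
      have h0 := mul_le_mul_of_nonneg_left (H.abs_table_le hp hs hs0 hs1 i hb0 F) hs1'
      have h1 := mul_le_mul_of_nonneg_left (H.abs_table_le hp hs hs0 hs1 i hb1 F) hs0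
      refine (add_le_add h0 h1).trans (le_of_eq ?_)
      simp only [exactTable]; ring
    have hG := (abs_localSum_le _ _ _ _ _ _).trans
      (H.localAbsSum_le hp hs hs0 hs1 hv hv' hx (F + 1))
    have h0 := mul_le_mul_of_nonneg_left (ih hb0) hs1'
    have h1 := mul_le_mul_of_nonneg_left (ih hb1) hs0
    rw [H.errorTable_succ hp hs hv hv']
    refine (abs_add_le _ _).trans ((add_le_add (abs_add_le _ _) le_rfl).trans ?_)
    rw [abs_mul, abs_mul, abs_of_nonneg hs0, abs_of_nonneg hs1']
    refine (add_le_add (add_le_add hG h0) h1).trans (le_of_eq ?_)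
    simp only [errorMajorant, eval_add, exactTable]
    ring

end KCompensated

open KCompensated in
theorem mainTheorem2 (K : ℕ) (hK : 1 ≤ K) :
    ∃ C : ℝ, ∀ n : ℕ, ∃ D u₀ : ℝ, 0 < u₀ ∧
      ∀ (p : ℕ) (fl : ℝ → ℝ), IsRoundToNearest p fl → unitRoundoff p ≤ u₀ →
      ∀ (b : ℕ → ℝ) (s : ℝ), (∀ j ≤ n, IsFloat p (b j)) → IsFloat p s → 0 ≤ s → s ≤ 1 →
        |globalError p fl n b s (K - 1) 0 0 - computed p fl n b s (K - 1) 0 0|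
            = |globalError p fl n b s K 0 0| ∧
        |globalError p fl n b s K 0 0|
          ≤ ((3 ^ K * (n.choose K : ℝ) + C * (n : ℝ) ^ (K - 1)) * unitRoundoff p ^ K
              + D * unitRoundoff p ^ (K + 1)) * absBernsteinSum n b s := by
  obtain ⟨F, rfl⟩ : ∃ F, K = F + 1 := ⟨K - 1, by omega⟩
  obtain ⟨a, -, ha⟩ := exists_majorant_le localConst_nonneg F
  refine ⟨a, fun n => ?_⟩
  obtain ⟨D, hD⟩ := exists_eval_le (errorMajorant localConst n (F + 1))
  refine ⟨D, (2 : ℝ)⁻¹ ^ 4, by positivity, fun p fl H hpu b s hb hs hs0 hs1 => ⟨rfl, ?_⟩⟩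
  have hu := unitRoundoff_nonneg p
  have hbound := H.abs_errorTable_le (le_of_unitRoundoff_le hpu) hs hs0 hs1 n (j := 0)
    (fun l hl => by rw [zero_add]; exact hb l hl) F
  rw [exactTable_abs_eq_absBernsteinSum] at hbound
  rw [globalError_eq_errorTable, Nat.sub_zero]
  refine hbound.trans (mul_le_mul_of_nonneg_right ?_ ?_)
  · have h := (hD _ hu (unitRoundoff_le_one p)).trans
      (add_le_add_left ((eval_errorMajorant _ _ _).trans_le (ha n).2) _)
    refine (mul_le_mul_of_nonneg_left h (by positivity)).trans (le_of_eq ?_)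
    rw [Nat.add_sub_cancel]; ring
  · refine Finset.sum_nonneg fun j _ => mul_nonneg (abs_nonneg _) ?_
    have hs1' : 0 ≤ 1 - s := sub_nonneg.2 hs1
    simp only [bernsteinPolynomial, Polynomial.eval_mul, Polynomial.eval_pow, Polynomial.eval_X,
      Polynomial.eval_sub, Polynomial.eval_one, Polynomial.eval_natCast]
    positivity
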